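/- Let $F$ be a finite field with $q\ge n$ elements, let $k\le n$, $\alpha$, $z_{ro},z_{wo},z_{rw}$ be nonnegative integers, and put $z_r=z_{ro}+z_{rw}$, $z_w=z_{wo}+z_{rw}$, $c=3z_{rw}+2z_{wo}+z_{ro}=z_r+2z_w$; assume $z_r<k$. All entropies and amounts of information are in base $q$. A scheme consists of a random secret $S$ (in a finite alphabet) and shares $W_1,\dots,W_n\in F^\alpha$ with a joint law such that $H(S\mid W_Z)=H(S)$ for all $Z\subseteq[n]$ with $|Z|=z_r$ (privacy) and $H(S\mid W_A)=0$ for all $A\subseteq[n]$ with $|A|=k$ (resiliency). It has error at most $\varepsilon$ if, for every $k$ parties, a user that downloads their whole shares has a decoder that errs with probability at most $\varepsilon$ whichever at most $z_w$ parties an omniscient adversary (knowing $S$ and all shares) corrupts and whatever these parties send instead. A user that contacts a set $D$ of $d$ parties, $k\le d\le n$, uses a protocol: each $i\in D$ reads a fixed set of symbols of $W_i$, sends a function of these symbols, and the user decodes from the (possibly corrupted) messages; the read cost is the total number of symbols read, and the communication cost is $\sum_{i\in D}\log_q$ of the number of possible messages of $i$. The error of such a protocol is measured against the same adversary. **Capacity.**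 The capacity, i.e. the largest $H$ such that for every $\varepsilon>0$ there is a scheme with error at most $\varepsilon$ and $H(S)\ge H$, is $$C^{\mathrm O}(n,k,\mathbf z)=\begin{cases}(k-z_r-2z_w)\alpha & \text{if } k>3z_{rw}+2z_{wo}+z_{ro},\\ 0&\text{otherwise.}\end{cases}$$ **Costs.** Let $k>c$. For every $D$ with $|D|=d\ge k$, if for every $\varepsilon>0$ there are a scheme with $H(S)\ge C^{\mathrm O}$ and error at most $\varepsilon$ and a protocol for $D$ with error at most $\varepsilon$ and communication cost (respectively read cost) at most $\kappa$, then $$\kappa\ \ge\ d\,\frac{(k-3z_{rw}-2z_{wo}-z_{ro})\alpha}{d-3z_{rw}-2z_{wo}-z_{ro}}.$$ If moreover $\frac{(k-c)\alpha}{d-c}$ is an integer for every $d\in\{k,\dots,n\}$, then the minimum of these $\kappa$ equals the right-hand side, so $$\mathrm{RC}(d)=\mathrm{CC}(d)=d\,\frac{(k-3z_{rw}-2z_{wo}-z_{ro})\alpha}{d-3z_{rw}-2z_{wo}-z_{ro}},$$ and there is a single scheme, with zero error, with $H(S)=C^{\mathrm O}$, and with zero-error protocols of exactly these read and communication costs for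 all $D$ with $|D|\ge k$. **Staircase codes.** In the last case, for any distinct nonzero $x_1,\dots,x_n\in F$ (which exist if $q>n$), the following Staircase code is such a scheme. Put $t=k-2z_w$, $N=n-2z_w$, $z=z_r$, $\alpha_e=\frac{(t-z)\alpha}{e-z}$ for $t\le e\le N$. Let $M=[M_N\mid M_{N-1}\mid\cdots\mid M_t]$ be the $N\times\alpha$ matrix over $F$ in which the blocks $M_N,\dots,M_e$ together have $\alpha_e$ columns; $M_N$ has the symbols of the secret in its first $N-z$ rows and random symbols in the other $z$ rows; and $M_e$, for $t\le e<N$, has in its first $e-z$ rows the $(e+1)$-th row of $[M_N\mid\cdots\mid M_{e+1}]$ wrapped around, random symbols in the next $z$ rows, and zeros below. All secret and random symbols are independent and uniform. The share of party $i$ is the $i$-th row of $VM$, $V=(x_i^{r})_{1\le i\le n,\,0\le r<N}$. A user contacting $d$ parties downloads the first $\alpha_{d-2z_w}$ symbols of each contacted share as they are, and decodes the secret with zero error in the presence of up to $z_w$ corrupted parties. -/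

import Mathlib

open scoped BigOperators

universe u

noncomputable section

namespace SecretSharing

/-- Shannon entropy, with logarithms in base `b`, of the random variable `f` under the law `P`. -/
def entropy {A : Type*} {X : Type*} [Fintype X] (b : ℝ) (P : PMF A) (f : A → X) : ℝ :=
  -∑ x : X, (P.map f x).toReal * Real.logb b (P.map f x).toReal

/-- Conditional Shannon entropy `H(f | g) = -∑ p(x,y) log_b (p(x,y) / p(y))` under the law `P`. -/
def condEntropy {A : Type*} {X Y : Type*} [Fintype X] [Fintype Y] (b : ℝ) (P : PMF A)
    (f : A → X) (g : A → Y) : ℝ :=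
  -∑ x : X, ∑ y : Y, (P.map (fun a => (f a, g a)) (x, y)).toReal *
    Real.logb b ((P.map (fun a => (f a, g a)) (x, y)).toReal / (P.map g y).toReal)

/-- A dealer's scheme with `n` parties whose shares consist of `α` symbols of `F`: a finite secret
alphabet and the joint law of the secret and of the `n` shares. -/
structure Scheme (F : Type u) (n α : ℕ) where
  Secret : Type u
  [fintypeSecret : Fintype Secret]
  law : PMF (Secret × (Fin n → Fin α → F))

attribute [instance] Scheme.fintypeSecret

/-- A non-interactive protocol by which a user that contacts the parties in `D` recovers the
secret: party `i ∈ D` reads the symbols of its share at the positions `read i`, and sends a message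
that is a function of these symbols only; the user decodes from the messages it receives. -/
structure Protocol {F : Type u} {n α : ℕ} (C : Scheme F n α) (D : Finset (Fin n)) where
  read : D → Finset (Fin α)
  Msg : D → Type u
  [fintypeMsg : ∀ i, Fintype (Msg i)]
  send : ∀ i : D, (read i → F) → Msg i
  decode : (∀ i : D, Msg i) → C.Secret

attribute [instance] Protocol.fintypeMsg

namespace Protocol

variable {F : Type u} {n α : ℕ} {C : Scheme F n α} {D : Finset (Fin n)}

/-- Total number of symbols read by the contacted parties. -/
def readCost (p : Protocol C D) : ℝ := ∑ i : D, ((p.read i).card : ℝ)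

/-- Total amount of information, in symbols of `F`, sent by the contacted parties. -/
def commCost [Fintype F] (p : Protocol C D) : ℝ :=
  ∑ i : D, Real.logb (Fintype.card F) (Fintype.card (p.Msg i))

/-- What the user receives when the shares are `w`, the parties in `T` are malicious, and `y` is
what the adversary makes the malicious parties send. -/
def received (p : Protocol C D) (w : Fin n → Fin α → F) (T : Finset (Fin n))
    (y : ∀ i : D, p.Msg i) : ∀ i : D, p.Msg i :=
  fun i => if (i : Fin n) ∈ T then y i else p.send i (fun j => w i j)

/-- The probability that the decoded secret is wrong, when the parties in `T` are malicious and the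
omniscient adversary chooses their messages by the rule `forge`, knowing the secret and all
shares. -/
def errorProb (p : Protocol C D) (T : Finset (Fin n))
    (forge : C.Secret × (Fin n → Fin α → F) → ∀ i : D, p.Msg i) : ℝ :=
  (C.law.toOuterMeasure {x | p.decode (p.received x.2 T (forge x)) ≠ x.1}).toReal

/-- Whichever (at most) `zw` parties an omniscient adversary corrupts, and however it does it, the
user decodes a wrong secret with probability at most `ε`. -/
def ErrorAtMost (p : Protocol C D) (zw : ℕ) (ε : ℝ) : Prop :=
  ∀ T : Finset (Fin n), T.card ≤ zw →
    ∀ forge : C.Secret × (Fin n → Fin α → F) → ∀ i : D, p.Msg i, p.errorProb T forge ≤ ε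

end Protocol

namespace Scheme

variable {F : Type u} {n α : ℕ}

/-- The shares of the parties in `A`. -/
def sharesOf (C : Scheme F n α) (A : Finset (Fin n)) :
    C.Secret × (Fin n → Fin α → F) → A → Fin α → F :=
  fun x i => x.2 i

/-- The size of the secret: its entropy, in symbols of `F`. -/
def size [Fintype F] (C : Scheme F n α) : ℝ := entropy (Fintype.card F) C.law Prod.fst

/-- Perfect privacy: any `zr` shares give no information about the secret. -/
def IsPrivate [Fintype F] (C : Scheme F n α) (zr : ℕ) : Prop :=
  ∀ Z : Finset (Fin n), Z.card = zr →
    condEntropy (Fintype.card F) C.law Prod.fst (C.sharesOf Z) =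
      entropy (Fintype.card F) C.law Prod.fst

/-- Resiliency: any `k` (uncorrupted) shares determine the secret. -/
def IsResilient [Fintype F] (C : Scheme F n α) (k : ℕ) : Prop :=
  ∀ A : Finset (Fin n), A.card = k →
    condEntropy (Fintype.card F) C.law Prod.fst (C.sharesOf A) = 0

/-- The protocol in which each contacted party reads the symbols of its share at the positions in
`R` and sends them as they are. -/
def plainDownload [Fintype F] (C : Scheme F n α) (D : Finset (Fin n)) (R : Finset (Fin α))
    (dec : (D → R → F) → C.Secret) : Protocol C D where
  read := fun _ => R
  Msg := fun _ => R → F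
  send := fun _ v => v
  decode := dec

/-- The scheme is private against `zr` eavesdropped parties, resilient with threshold `k`, and a
user that downloads the whole shares of any `k` parties decodes the secret with probability of error
at most `ε` in the presence of an omniscient adversary that corrupts `zw` parties. -/
def IsReliable [Fintype F] (C : Scheme F n α) (k zr zw : ℕ) (ε : ℝ) : Prop :=
  C.IsPrivate zr ∧ C.IsResilient k ∧
    ∀ A : Finset (Fin n), A.card = k →
      ∃ dec, (C.plainDownload A Finset.univ dec).ErrorAtMost zw ε

end Scheme

/-- The secret sizes `H` that can be shared: for every `ε > 0` there is a scheme with a secret of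
size at least `H` and probability of error at most `ε`. -/
def achievableSizes (F : Type u) [Fintype F] (n k zr zw α : ℕ) : Set ℝ :=
  {H | ∀ ε : ℝ, 0 < ε → ∃ C : Scheme F n α, C.IsReliable k zr zw ε ∧ H ≤ C.size}

/-- The communication costs at which a user contacting the parties in `D` can decode, in schemes
with a secret of size at least `H`, with arbitrarily small probability of error. -/
def commCosts (F : Type u) [Fintype F] (n k zr zw α : ℕ) (H : ℝ) (D : Finset (Fin n)) : Set ℝ :=
  {κ | ∀ ε : ℝ, 0 < ε → ∃ C : Scheme F n α, C.IsReliable k zr zw ε ∧ H ≤ C.size ∧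
    ∃ p : Protocol C D, p.ErrorAtMost zw ε ∧ p.commCost ≤ κ}

/-- The read costs at which a user contacting the parties in `D` can decode, in schemes with a
secret of size at least `H`, with arbitrarily small probability of error. -/
def readCosts (F : Type u) [Fintype F] (n k zr zw α : ℕ) (H : ℝ) (D : Finset (Fin n)) : Set ℝ :=
  {κ | ∀ ε : ℝ, 0 < ε → ∃ C : Scheme F n α, C.IsReliable k zr zw ε ∧ H ≤ C.size ∧
    ∃ p : Protocol C D, p.ErrorAtMost zw ε ∧ p.readCost ≤ κ}

/-- The claimed capacity, in symbols of `F`, with `zro` read-only, `zwo` write-only and `zrw`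
read-write parties: `(k - z_r - 2 z_w) α` if `k > 3 z_rw + 2 z_wo + z_ro`, and `0` otherwise. -/
def omniscientCapacity (k zro zwo zrw α : ℕ) : ℝ :=
  if 3 * zrw + 2 * zwo + zro < k then ((k : ℝ) - (zro + zrw) - 2 * (zwo + zrw)) * α else 0

/-- The claimed minimum cost `d (k - c) α / (d - c)`, `c = 3 z_rw + 2 z_wo + z_ro`, of a user that
contacts `d` parties. -/
def optimalCost (k zro zwo zrw α d : ℕ) : ℝ :=
  (d : ℝ) * (((k : ℝ) - 3 * zrw - 2 * zwo - zro) * α) / ((d : ℝ) - 3 * zrw - 2 * zwo - zro)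

/-- Number of symbols sent by each party when `e` parties are contacted, in a Staircase code with
threshold `t`, privacy `z` and shares of `α` symbols. It equals `α` at `e = t`. -/
def stairWidth (t z α e : ℕ) : ℕ := (t - z) * α / (e - z)

/-- The message matrices `M = [M_N | ⋯ | M_{t+1} | M_t]` of the (universal) Staircase code with
parameters `t ≤ N`, `z < t`. The block `M_N` consists of the first `stairWidth t z α N` columns, and
`M_e`, for `t ≤ e < N`, of the columns `c` with `stairWidth t z α (e+1) ≤ c < stairWidth t z α e`.
In `M_N` the first `N - z` rows hold the secret and the other `z` rows are random. In `M_e` with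
`e < N` the first `e - z` rows hold the row `e` (counted from `0`) of the preceding blocks, wrapped
around to fill an `(e - z) × (stairWidth t z α e - stairWidth t z α (e+1))` matrix, the next `z` rows
are random, and the rows from `e` on are zero. -/
structure IsStaircaseMatrix {F : Type u} [Zero F] (t z N α : ℕ) (M : Matrix (Fin N) (Fin α) F) :
    Prop where
  copy : ∀ (e r : Fin N) (c l : Fin α), t ≤ (e : ℕ) →
    stairWidth t z α (e + 1) ≤ (c : ℕ) → (c : ℕ) < stairWidth t z α e → (r : ℕ) + z < e →
    (l : ℕ) = r * (stairWidth t z α e - stairWidth t z α (e + 1)) +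
      (c - stairWidth t z α (e + 1)) →
    M r c = M e l
  zero : ∀ (e r : Fin N) (c : Fin α), t ≤ (e : ℕ) →
    stairWidth t z α (e + 1) ≤ (c : ℕ) → (c : ℕ) < stairWidth t z α e → (e : ℕ) ≤ r →
    M r c = 0

open Classical in
/-- The Staircase code with evaluation points `x`: the secret and the random symbols, that is, the
free entries of the message matrix `M`, are independent and uniform, and party `i` gets the `i`-th
row of `V * M`, where `V` is the Vandermonde matrix of `x`. -/
def staircaseCode {F : Type u} [Field F] [Fintype F] {n : ℕ} (x : Fin n → F) (t z N α : ℕ) :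
    Scheme F n α where
  Secret := {p : Fin N × Fin α // (p.1 : ℕ) + z < N ∧ (p.2 : ℕ) < stairWidth t z α N} → F
  law := (PMF.uniformOfFinset
      (Finset.univ.filter fun M : Matrix (Fin N) (Fin α) F => IsStaircaseMatrix t z N α M)
      ⟨0, by
        simp only [Finset.mem_filter, Finset.mem_univ, true_and]
        exact ⟨fun _ _ _ _ _ _ _ _ _ => rfl, fun _ _ _ _ _ _ _ => rfl⟩⟩).map
    fun M => (fun p => M p.1.1 p.1.2, fun i c => ∑ r : Fin N, x i ^ (r : ℕ) * M r c)

end SecretSharing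

end

/-!
Converse: two disjoint sets of `z_w` parties can each pretend that the state is another one with
the same messages elsewhere, so a user who tolerates `z_w` corrupted parties decodes almost
correctly only if the messages outside any `2 z_w` contacted parties nearly determine the secret,
in the sense of Fano's inequality. Of these, the messages of any `z_r` parties are independent of
the secret, so any `d - c` messages have total size at least `H(S)`, up to terms that vanish with
the error. Averaging over the subsets of size `d - c` gives the bound on the cost.

Achievability: by linearity, decoding with zero error means that a staircase matrix whose encoded
prefix vanishes at `e = d - 2 z_w` parties encodes the zero secret. By the invertibility of
Vandermonde matrices, a column of the prefix vanishes if its entries in the rows `r ≥ e` do; each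
of these is zero or copied to the block `M_r`, in which only rows above `r` are nonzero, so
induction on `r` applies. For privacy, every secret can be completed, column by column, to a
staircase matrix that encodes to zero at any given `z_r` parties.
-/

namespace SecretSharing

open Filter Topology

section Entropy

variable {A X Y G : Type*} {b : ℝ} {P : PMF A} {f : A → X} {g : A → Y}

/-- The probability, as a real number, that the random variable `f` takes the value `x`. -/
noncomputable def prob (P : PMF A) (f : A → X) (x : X) : ℝ := (P.map f x).toReal

theorem prob_nonneg (x : X) : 0 ≤ prob P f x := ENNReal.toReal_nonneg

theorem prob_apply_pos {a : A} (ha : a ∈ P.support) : 0 < prob P f (f a) :=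
  ENNReal.toReal_pos ((PMF.mem_support_map_iff f P _).2 ⟨a, ha, rfl⟩) (PMF.apply_ne_top _ _)

theorem exists_mem_support_of_prob_ne_zero {x : X} (hx : prob P f x ≠ 0) :
    ∃ a ∈ P.support, f a = x :=
  (PMF.mem_support_map_iff f P x).1 fun h => hx (by rw [prob, h, ENNReal.toReal_zero])

theorem sum_prob [Fintype X] (P : PMF A) (f : A → X) : ∑ x, prob P f x = 1 := by
  have h := (P.map f).tsum_coe
  rw [tsum_fintype] at h
  simp only [prob]
  rw [← ENNReal.toReal_sum fun x _ => PMF.apply_ne_top _ x, h, ENNReal.toReal_one]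

theorem sum_prob_prodMk [Fintype X] (P : PMF A) (f : A → X) (g : A → Y) (y : Y) :
    ∑ x, prob P (fun a => (f a, g a)) (x, y) = prob P g y := by
  have hg : P.map g = (P.map fun a => (f a, g a)).map Prod.snd :=
    (PMF.map_comp (fun a => (f a, g a)) P Prod.snd).symm
  classical
  simp only [prob]
  rw [hg, PMF.map_apply, ENNReal.tsum_prod', tsum_fintype,
    ← ENNReal.toReal_sum fun x _ => PMF.apply_ne_top _ (x, y)]
  simp only [eq_comm (a := y), tsum_ite_eq]

theorem prob_prodMk_le [Finite X] (x : X) (y : Y) :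
    prob P (fun a => (f a, g a)) (x, y) ≤ prob P g y := by
  have := Fintype.ofFinite X
  rw [← sum_prob_prodMk P f g y]
  exact Finset.single_le_sum (f := fun x => prob P (fun a => (f a, g a)) (x, y))
    (fun _ _ => prob_nonneg _) (Finset.mem_univ x)

theorem prob_mul_logb_div_nonpos [Finite X] (hb : 1 < b) (x : X) (y : Y) :
    prob P (fun a => (f a, g a)) (x, y) *
      Real.logb b (prob P (fun a => (f a, g a)) (x, y) / prob P g y) ≤ 0 :=
  mul_nonpos_of_nonneg_of_nonpos (prob_nonneg _) <|
    Real.logb_nonpos hb (div_nonneg (prob_nonneg _) (prob_nonneg _))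
      (div_le_one_of_le₀ (prob_prodMk_le x y) (prob_nonneg _))

theorem prob_equiv_comp (e : X ≃ Y) (x : X) : prob P (fun a => e (f a)) (e x) = prob P f x := by
  classical
  simp only [prob, PMF.map_apply, e.injective.eq_iff]

theorem entropy_equiv_comp [Fintype X] [Fintype Y] (e : X ≃ Y) :
    entropy b P (fun a => e (f a)) = entropy b P f := by
  change -∑ y, prob P (fun a => e (f a)) y * Real.logb b (prob P (fun a => e (f a)) y) =
    -∑ x, prob P f x * Real.logb b (prob P f x)
  simp only [← Equiv.sum_comp e, prob_equiv_comp]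

theorem entropy_eq_logb_card [Fintype X] (h : ∀ x x', prob P f x = prob P f x') :
    entropy b P f = Real.logb b (Fintype.card X) := by
  have hinv : ∀ x, prob P f x = (Fintype.card X : ℝ)⁻¹ := fun x => by
    refine eq_inv_of_mul_eq_one_right ?_
    rw [← sum_prob P f, Finset.sum_congr rfl fun x' _ => h x' x, Finset.sum_const,
      Finset.card_univ, nsmul_eq_mul]
  calc entropy b P f = ∑ x, prob P f x * Real.logb b (Fintype.card X) := by
        rw [entropy, ← Finset.sum_neg_distrib]
        refine Finset.sum_congr rfl fun x _ => ?_
        change -(prob P f x * Real.logb b (prob P f x)) = _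
        rw [hinv, Real.logb_inv, mul_neg, neg_neg]
    _ = Real.logb b (Fintype.card X) := by rw [← Finset.sum_mul, sum_prob, one_mul]

/-- The law of the value to be guessed, given the observation `y`, against which Gibbs' inequality
yields Fano's: mass `1 - δ` on the guess, and mass `δ` spread over `s`, a set of at most `m`
values. -/
noncomputable def fanoKernel [DecidableEq X] (s : Finset X) (m : ℕ) (δ : ℝ)
    (guess : Y → X) (x : X) (y : Y) : ℝ :=
  (if x = guess y then 1 - δ else 0) + if x ∈ s then δ / m else 0

section FanoKernel

variable [DecidableEq X] {s : Finset X} {m : ℕ} {δ : ℝ}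

theorem div_le_fanoKernel (hδ1 : δ ≤ 1) (guess : Y → X) {x : X} (hx : x ∈ s) (y : Y) :
    δ / m ≤ fanoKernel s m δ guess x y := by
  simp only [fanoKernel, hx, if_true]
  split_ifs <;> linarith

theorem fanoKernel_nonneg (hδ0 : 0 ≤ δ) (hδ1 : δ ≤ 1) (guess : Y → X) (x : X) (y : Y) :
    0 ≤ fanoKernel s m δ guess x y := by
  have := sub_nonneg.2 hδ1
  simp only [fanoKernel]
  positivity

theorem sum_fanoKernel_le_one [Fintype X] (hδ0 : 0 ≤ δ) (hsm : s.card ≤ m) (guess : Y → X)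
    (y : Y) : ∑ x, fanoKernel s m δ guess x y ≤ 1 := by
  have hsm' : (s.card : ℝ) ≤ m := by exact_mod_cast hsm
  have hspread : s.card * (δ / m) ≤ δ := by
    rw [mul_div_left_comm]
    exact mul_le_of_le_one_right hδ0 (div_le_one_of_le₀ hsm' (by positivity))
  simp only [fanoKernel, Finset.sum_add_distrib, Finset.sum_ite_eq',
    Finset.mem_univ, if_true, Finset.sum_ite_mem, Finset.univ_inter, Finset.sum_const,
    nsmul_eq_mul]
  linarith

theorem neg_logb_fanoKernel_le (hb : 1 < b) (hm : 0 < m) (hδ0 : 0 < δ) (hδ1 : δ < 1)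
    (guess : Y → X) {x : X} (hx : x ∈ s) (y : Y) :
    -Real.logb b (fanoKernel s m δ guess x y) ≤
      -Real.logb b (1 - δ) + if x ≠ guess y then Real.logb b (m / δ) else 0 := by
  have hδ' : 0 < 1 - δ := sub_pos.2 hδ1
  have hδm : 0 < δ / m := by positivity
  split_ifs with hne
  · have hle := Real.logb_le_logb_of_le hb hδm (div_le_fanoKernel hδ1.le guess hx y)
    have hδlog := Real.logb_nonpos hb hδ'.le (by linarith)
    rw [← inv_div, Real.logb_inv]
    linarith
  · rw [add_zero, neg_le_neg_iff]
    refine Real.logb_le_logb_of_le hb hδ' ?_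
    simp only [fanoKernel, not_not.1 hne, if_true, le_add_iff_nonneg_right]
    positivity

end FanoKernel

section CondEntropy

variable [Fintype X] [Fintype Y]

theorem condEntropy_eq_neg_sum (b : ℝ) (P : PMF A) (f : A → X) (g : A → Y) :
    condEntropy b P f g = -∑ x, ∑ y, prob P (fun a => (f a, g a)) (x, y) *
      Real.logb b (prob P (fun a => (f a, g a)) (x, y) / prob P g y) :=
  rfl

theorem condEntropy_eq_entropy_sub (b : ℝ) (P : PMF A) (f : A → X) (g : A → Y) :
    condEntropy b P f g = entropy b P (fun a => (f a, g a)) - entropy b P g := by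
  have hlog : ∀ x y, prob P (fun a => (f a, g a)) (x, y) *
      Real.logb b (prob P (fun a => (f a, g a)) (x, y) / prob P g y) =
      prob P (fun a => (f a, g a)) (x, y) * Real.logb b (prob P (fun a => (f a, g a)) (x, y)) -
        prob P (fun a => (f a, g a)) (x, y) * Real.logb b (prob P g y) := by
    intro x y
    rcases (prob_nonneg (P := P) (f := fun a => (f a, g a)) (x, y)).eq_or_lt with h | h
    · simp [← h]
    · rw [Real.logb_div h.ne' (h.trans_le (prob_prodMk_le x y)).ne', mul_sub]
  have hg : entropy b P g = -∑ y, ∑ x,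
      prob P (fun a => (f a, g a)) (x, y) * Real.logb b (prob P g y) := by
    simp only [← Finset.sum_mul, sum_prob_prodMk]
    rfl
  have hfg : entropy b P (fun a => (f a, g a)) = -∑ x, ∑ y,
      prob P (fun a => (f a, g a)) (x, y) *
        Real.logb b (prob P (fun a => (f a, g a)) (x, y)) := by
    rw [← Fintype.sum_prod_type']
    rfl
  rw [condEntropy_eq_neg_sum, hfg, hg, Finset.sum_comm (γ := Y)]
  simp only [hlog, Finset.sum_sub_distrib]
  ring

theorem condEntropy_nonneg (hb : 1 < b) (P : PMF A) (f : A → X) (g : A → Y) :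
    0 ≤ condEntropy b P f g :=
  neg_nonneg.2 <| Finset.sum_nonpos fun x _ => Finset.sum_nonpos fun y _ =>
    prob_mul_logb_div_nonpos hb x y

theorem condEntropy_eq_zero_iff_prob (hb : 1 < b) :
    condEntropy b P f g = 0 ↔ ∀ x y, prob P (fun a => (f a, g a)) (x, y) ≠ 0 →
      prob P (fun a => (f a, g a)) (x, y) = prob P g y := by
  rw [condEntropy_eq_neg_sum, neg_eq_zero, Finset.sum_eq_zero_iff_of_nonpos fun x _ =>
    Finset.sum_nonpos fun y _ => prob_mul_logb_div_nonpos hb x y]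
  refine forall_congr' fun x => ?_
  rw [Finset.sum_eq_zero_iff_of_nonpos fun y _ => prob_mul_logb_div_nonpos hb x y]
  simp only [Finset.mem_univ, forall_const]
  refine forall_congr' fun y => ?_
  rw [mul_eq_zero, or_iff_not_imp_left]
  refine imp_congr_right fun h => ?_
  have hpos := (prob_nonneg (P := P) (f := fun a => (f a, g a)) (x, y)).lt_of_ne' h
  have hpos' : 0 < prob P g y := hpos.trans_le (prob_prodMk_le x y)
  have hb' : b ≠ 0 ∧ b ≠ 1 ∧ b ≠ -1 := ⟨by linarith, by linarith, by linarith⟩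
  have hd := div_pos hpos hpos'
  rw [Real.logb_eq_zero, ← div_eq_one_iff_eq hpos'.ne']
  simp only [hb'.1, hb'.2.1, hb'.2.2, hd.ne', false_or, or_iff_left_iff_imp]
  intro h
  linarith

theorem condEntropy_eq_zero_iff (hb : 1 < b) :
    condEntropy b P f g = 0 ↔
      ∀ a ∈ P.support, ∀ a' ∈ P.support, g a = g a' → f a = f a' := by
  rw [condEntropy_eq_zero_iff_prob hb]
  classical
  constructor
  · intro h a ha a' ha' hg
    by_contra hne
    have hpos : ∀ c ∈ P.support, 0 < prob P (fun a => (f a, g a)) (f c, g c) :=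
      fun c hc => prob_apply_pos (f := fun a => (f a, g a)) hc
    have hpair := Finset.sum_le_sum_of_subset_of_nonneg (Finset.subset_univ {f a, f a'})
      fun x _ _ => prob_nonneg (P := P) (f := fun a => (f a, g a)) (x, g a)
    rw [sum_prob_prodMk, Finset.sum_pair hne, h _ _ (hpos a ha).ne'] at hpair
    have := hg ▸ hpos a' ha'
    linarith
  · intro h x y hxy
    obtain ⟨a, ha, hax⟩ := exists_mem_support_of_prob_ne_zero hxy
    obtain ⟨rfl, rfl⟩ := Prod.mk.inj hax
    rw [← sum_prob_prodMk P f g (g a)]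
    symm
    refine Finset.sum_eq_single_of_mem (f a) (Finset.mem_univ _) fun x _ hx => ?_
    by_contra hne
    obtain ⟨a', ha', hax'⟩ := exists_mem_support_of_prob_ne_zero hne
    obtain ⟨rfl, hg⟩ := Prod.mk.inj hax'
    exact hx (h a' ha' a ha hg)

theorem condEntropy_eq_logb_card (h : ∀ x x' y,
    prob P (fun a => (f a, g a)) (x, y) = prob P (fun a => (f a, g a)) (x', y)) :
    condEntropy b P f g = Real.logb b (Fintype.card X) := by
  have hdiv : ∀ x y, prob P (fun a => (f a, g a)) (x, y) = prob P g y / Fintype.card X := by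
    intro x y
    have := Fintype.card_pos_iff.2 ⟨x⟩
    rw [eq_div_iff (by positivity), ← sum_prob_prodMk P f g y,
      Finset.sum_congr rfl fun x' _ => h x' x y, Finset.sum_const, Finset.card_univ,
      nsmul_eq_mul, mul_comm]
  have hterm : ∀ x y, -(prob P (fun a => (f a, g a)) (x, y) *
      Real.logb b (prob P (fun a => (f a, g a)) (x, y) / prob P g y)) =
      prob P (fun a => (f a, g a)) (x, y) * Real.logb b (Fintype.card X) := by
    intro x y
    by_cases h0 : prob P g y = 0
    · simp [hdiv, h0]
    · rw [hdiv, div_right_comm, div_self h0, one_div, Real.logb_inv, mul_neg, neg_neg]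
  rw [condEntropy_eq_neg_sum, Finset.sum_comm]
  simp only [← Finset.sum_neg_distrib, hterm, ← Finset.sum_mul, sum_prob_prodMk, sum_prob, one_mul]

theorem neg_mul_logb_div_le {p q r : ℝ} (hb : 1 < b) (hp : 0 < p) (hq : 0 < q) (hr : 0 < r) :
    -(p * Real.logb b (p / r)) ≤ p * -Real.logb b q + (q * r - p) / Real.log b := by
  have hlb : 0 < Real.log b := Real.log_pos hb
  have hlog : Real.log q - Real.log (p / r) ≤ q * r / p - 1 := by
    rw [← Real.log_div hq.ne' (by positivity), div_div_eq_mul_div]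
    exact Real.log_le_sub_one_of_pos (by positivity)
  have hmul := mul_le_mul_of_nonneg_left hlog hp.le
  rw [mul_sub, mul_sub, mul_div_cancel₀ _ hp.ne', mul_one] at hmul
  calc -(p * Real.logb b (p / r))
      = p * -Real.logb b q + (p * Real.log q - p * Real.log (p / r)) / Real.log b := by
        rw [Real.logb, Real.logb]
        ring
    _ ≤ p * -Real.logb b q + (q * r - p) / Real.log b := by gcongr

theorem condEntropy_le_of_sum_le_one (hb : 1 < b) {q : X → Y → ℝ} (hq0 : ∀ x y, 0 ≤ q x y)
    (hq1 : ∀ y, ∑ x, q x y ≤ 1) (hq : ∀ a ∈ P.support, 0 < q (f a) (g a)) :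
    condEntropy b P f g ≤
      ∑ x, ∑ y, prob P (fun a => (f a, g a)) (x, y) * -Real.logb b (q x y) := by
  have hlb : 0 < Real.log b := Real.log_pos hb
  have hterm : ∀ x y, -(prob P (fun a => (f a, g a)) (x, y) *
        Real.logb b (prob P (fun a => (f a, g a)) (x, y) / prob P g y)) ≤
      prob P (fun a => (f a, g a)) (x, y) * -Real.logb b (q x y) +
        (q x y * prob P g y - prob P (fun a => (f a, g a)) (x, y)) / Real.log b := by
    intro x y
    rcases (prob_nonneg (P := P) (f := fun a => (f a, g a)) (x, y)).eq_or_lt with h | h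
    · have := mul_nonneg (hq0 x y) (prob_nonneg (P := P) (f := g) y)
      rw [← h]
      simp only [zero_mul, neg_zero, zero_add, sub_zero]
      positivity
    · obtain ⟨a, ha, hax⟩ := exists_mem_support_of_prob_ne_zero h.ne'
      obtain ⟨rfl, rfl⟩ := Prod.mk.inj hax
      exact neg_mul_logb_div_le hb h (hq a ha) (prob_apply_pos ha)
  have hsum : ∑ x, ∑ y, (q x y * prob P g y - prob P (fun a => (f a, g a)) (x, y)) ≤ 0 := by
    rw [Finset.sum_comm]
    simp only [Finset.sum_sub_distrib, sum_prob_prodMk, ← Finset.sum_mul]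
    rw [sub_nonpos]
    exact Finset.sum_le_sum fun y _ => mul_le_of_le_one_left (prob_nonneg y) (hq1 y)
  rw [condEntropy_eq_neg_sum]
  simp only [← Finset.sum_neg_distrib]
  refine (Finset.sum_le_sum fun x _ => Finset.sum_le_sum fun y _ => hterm x y).trans ?_
  simp only [Finset.sum_add_distrib, ← Finset.sum_div]
  have := div_nonpos_of_nonpos_of_nonneg hsum hlb.le
  linarith

theorem condEntropy_le_logb_card (hb : 1 < b) (P : PMF A) (f : A → X) (g : A → Y) :
    condEntropy b P f g ≤ Real.logb b (Fintype.card X) := by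
  obtain ⟨a, -⟩ := P.support_nonempty
  have hX : 0 < Fintype.card X := Fintype.card_pos_iff.2 ⟨f a⟩
  refine (condEntropy_le_of_sum_le_one hb (q := fun _ _ => (Fintype.card X : ℝ)⁻¹)
    (fun _ _ => by positivity) (fun _ => ?_) fun _ _ => by positivity).trans_eq ?_
  · rw [Finset.sum_const, Finset.card_univ, nsmul_eq_mul, mul_inv_cancel₀ (by positivity)]
  · rw [Finset.sum_comm]
    simp only [Real.logb_inv, neg_neg, ← Finset.sum_mul, sum_prob_prodMk, sum_prob, one_mul]

theorem condEntropy_le_logb_card_add [Fintype G] (hb : 1 < b) (P : PMF A) (f : A → X)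
    (g : A → Y) (h : A → G) :
    condEntropy b P f g ≤
      Real.logb b (Fintype.card G) + condEntropy b P f (fun a => (g a, h a)) := by
  have hcard := condEntropy_le_logb_card hb P h g
  have hnonneg := condEntropy_nonneg hb P h (fun a => (f a, g a))
  have hcomm : entropy b P (fun a => (h a, g a)) = entropy b P (fun a => (g a, h a)) :=
    entropy_equiv_comp (f := fun a => (g a, h a)) (Equiv.prodComm Y G)
  have hassoc : entropy b P (fun a => (h a, (f a, g a))) =
      entropy b P (fun a => (f a, (g a, h a))) :=
    entropy_equiv_comp (f := fun a => (f a, (g a, h a)))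
      ((Equiv.prodAssoc X Y G).symm.trans (Equiv.prodComm (X × Y) G))
  rw [condEntropy_eq_entropy_sub] at hcard hnonneg ⊢
  rw [condEntropy_eq_entropy_sub]
  linarith

/-- The bound in Fano's inequality, with logarithms in base `b`, for a random variable with `m`
values that is guessed with error probability at most `δ`. The true binary entropy of `δ` is
`negMulLog δ + negMulLog (1 - δ)`; here the second term is replaced by the larger `-log (1 - δ)`. -/
noncomputable def fanoBound (b : ℝ) (m : ℕ) (δ : ℝ) : ℝ :=
  (δ * Real.log m + Real.negMulLog δ - Real.log (1 - δ)) / Real.log b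

theorem tendsto_fanoBound (b : ℝ) (m : ℕ) : Tendsto (fanoBound b m) (𝓝 0) (𝓝 0) := by
  have hlog : ContinuousAt (fun δ : ℝ => Real.log (1 - δ)) 0 :=
    ContinuousAt.log (by fun_prop) (by norm_num)
  have hcont : ContinuousAt (fanoBound b m) 0 :=
    (((continuousAt_id.mul continuousAt_const).add Real.continuous_negMulLog.continuousAt).sub
      hlog).div_const _
  simpa [fanoBound] using hcont.tendsto

theorem sum_prob_eq_toReal_toOuterMeasure (P : PMF A) (f : A → X) (s : Set X)
    [DecidablePred (· ∈ s)] :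
    (P.toOuterMeasure (f ⁻¹' s)).toReal = ∑ x, if x ∈ s then prob P f x else 0 := by
  rw [← PMF.toOuterMeasure_map_apply, PMF.toOuterMeasure_apply_fintype,
    ENNReal.toReal_sum fun x _ => ?_]
  · refine Finset.sum_congr rfl fun x _ => ?_
    by_cases hx : x ∈ s <;> simp [hx, prob]
  · exact ne_top_of_le_ne_top (PMF.apply_ne_top _ x) (Set.indicator_le_self s _ x)

theorem sum_prob_fst_ne_eq [DecidableEq X] (P : PMF A) (f : A → X) (g : A → Y) (guess : Y → X) :
    ∑ x, ∑ y, (if x ≠ guess y then prob P (fun a => (f a, g a)) (x, y) else 0) =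
      (P.toOuterMeasure {a | f a ≠ guess (g a)}).toReal := by
  classical
  rw [← Fintype.sum_prod_type']
  exact (sum_prob_eq_toReal_toOuterMeasure P (fun a => (f a, g a))
    {xy | xy.1 ≠ guess xy.2}).symm

theorem sum_prob_mul_neg_logb_fanoKernel_le [DecidableEq X] (hb : 1 < b) {m : ℕ} (hm : 0 < m)
    {s : Finset X} (hs : ∀ a ∈ P.support, f a ∈ s) {δ : ℝ} (hδ0 : 0 < δ) (hδ1 : δ < 1)
    (guess : Y → X) :
    ∑ x, ∑ y, prob P (fun a => (f a, g a)) (x, y) *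
        -Real.logb b (fanoKernel s m δ guess x y) ≤
      -Real.logb b (1 - δ) +
        (P.toOuterMeasure {a | f a ≠ guess (g a)}).toReal * Real.logb b (m / δ) := by
  set p : X → Y → ℝ := fun x y => prob P (fun a => (f a, g a)) (x, y)
  have hterm : ∀ x y, p x y * -Real.logb b (fanoKernel s m δ guess x y) ≤
      p x y * -Real.logb b (1 - δ) +
        (if x ≠ guess y then p x y else 0) * Real.logb b (m / δ) := by
    intro x y
    by_cases h : p x y = 0
    · simp [h]
    obtain ⟨a, ha, hax⟩ := exists_mem_support_of_prob_ne_zero h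
    have hx : x ∈ s := (Prod.mk.inj hax).1 ▸ hs a ha
    rw [ite_mul, zero_mul, ← mul_ite_zero, ← mul_add]
    exact mul_le_mul_of_nonneg_left (neg_logb_fanoKernel_le hb hm hδ0 hδ1 guess hx y)
      (prob_nonneg _)
  have hp1 : ∑ x, ∑ y, p x y = 1 := by
    rw [← Fintype.sum_prod_type']
    exact sum_prob P _
  refine (Finset.sum_le_sum fun x _ => Finset.sum_le_sum fun y _ => hterm x y).trans_eq ?_
  simp only [Finset.sum_add_distrib, ← Finset.sum_mul, hp1, one_mul]
  rw [sum_prob_fst_ne_eq]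

theorem condEntropy_le_fanoBound (hb : 1 < b) {m : ℕ} {s : Finset X} (hsm : s.card ≤ m)
    (hs : ∀ a ∈ P.support, f a ∈ s) {δ : ℝ} (hδ0 : 0 < δ) (hδ1 : δ < 1) {guess : Y → X}
    (hguess : (P.toOuterMeasure {a | f a ≠ guess (g a)}).toReal ≤ δ) :
    condEntropy b P f g ≤ fanoBound b m δ := by
  classical
  obtain ⟨a₀, ha₀⟩ := P.support_nonempty
  have hm : 0 < m := (Finset.card_pos.2 ⟨f a₀, hs a₀ ha₀⟩).trans_le hsm
  have hm1 : (1 : ℝ) ≤ m := by exact_mod_cast hm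
  have hkernel_pos : ∀ a ∈ P.support, 0 < fanoKernel s m δ guess (f a) (g a) := fun a ha =>
    (by positivity : 0 < δ / m).trans_le (div_le_fanoKernel hδ1.le guess (hs a ha) _)
  calc condEntropy b P f g
      ≤ ∑ x, ∑ y, prob P (fun a => (f a, g a)) (x, y) *
          -Real.logb b (fanoKernel s m δ guess x y) :=
        condEntropy_le_of_sum_le_one hb (fanoKernel_nonneg hδ0.le hδ1.le guess)
          (sum_fanoKernel_le_one hδ0.le hsm guess) hkernel_pos
    _ ≤ -Real.logb b (1 - δ) +
          (P.toOuterMeasure {a | f a ≠ guess (g a)}).toReal * Real.logb b (m / δ) :=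
        sum_prob_mul_neg_logb_fanoKernel_le hb hm hs hδ0 hδ1 guess
    _ ≤ -Real.logb b (1 - δ) + δ * Real.logb b (m / δ) := by
        gcongr
        exact Real.logb_nonneg hb (by rw [le_div_iff₀ hδ0]; linarith)
    _ = fanoBound b m δ := by
        rw [fanoBound, Real.negMulLog, Real.logb, Real.logb,
          Real.log_div (by positivity) hδ0.ne']
        ring

end CondEntropy

end Entropy

section Converse

theorem exists_forall_eq_of_rel {A X Y : Type*} [Nonempty X] {R : Y → A → Prop} {f : A → X}
    (h : ∀ y a a', R y a → R y a' → f a = f a') : ∃ dec : Y → X, ∀ y a, R y a → dec y = f a := by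
  classical
  refine ⟨fun y => if hy : ∃ a, R y a then f hy.choose else Classical.arbitrary X,
    fun y a ha => ?_⟩
  have hy : ∃ a, R y a := ⟨a, ha⟩
  exact (dif_pos hy).trans (h y _ _ hy.choose_spec ha)

theorem toOuterMeasure_ne_top {A : Type*} (P : PMF A) (s : Set A) : P.toOuterMeasure s ≠ ⊤ :=
  ne_top_of_le_ne_top ENNReal.one_ne_top <|
    (P.toOuterMeasure_mono (Set.subset_univ _)).trans_eq
      ((P.toOuterMeasure_apply_eq_one_iff _).2 (Set.subset_univ _))

theorem exists_subset_card_mul_sum_le {ι : Type*} (f : ι → ℝ) {m : ℕ} (s : Finset ι)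
    (hm : m ≤ s.card) :
    ∃ G ⊆ s, G.card = m ∧ (s.card : ℝ) * ∑ i ∈ G, f i ≤ m * ∑ i ∈ s, f i := by
  classical
  induction hd : s.card - m generalizing s with
  | zero => exact ⟨s, Finset.Subset.refl _, by omega, by rw [show s.card = m by omega]⟩
  | succ k ih =>
    obtain ⟨x, hx, hmax⟩ := s.exists_max_image f (Finset.card_pos.1 (by omega))
    have hcard := Finset.card_erase_add_one hx
    obtain ⟨G, hG, hGm, hle⟩ := ih (s.erase x) (by omega) (by omega)
    have hGx : ∑ i ∈ G, f i ≤ m * f x := by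
      rw [← hGm, ← nsmul_eq_mul]
      exact Finset.sum_le_card_nsmul _ _ _ fun i hi =>
        hmax i (Finset.mem_of_mem_erase (hG hi))
    refine ⟨G, hG.trans (Finset.erase_subset _ _), hGm, ?_⟩
    rw [← hcard, ← Finset.add_sum_erase s f hx]
    push_cast
    linarith

theorem exists_cover_of_card_le {ι : Type*} [Fintype ι] {s : Finset ι} {a b : ℕ}
    (ha : a ≤ Fintype.card ι) (hs : s.card ≤ a + 2 * b) :
    ∃ Z T₁ T₂ : Finset ι, Z.card = a ∧ T₁.card ≤ b ∧ T₂.card ≤ b ∧ Disjoint T₁ T₂ ∧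
      ∀ i ∈ s, i ∈ Z ∨ i ∈ T₁ ∨ i ∈ T₂ := by
  classical
  obtain ⟨Z₀, hZ₀s, hZ₀⟩ := s.exists_subset_card_eq (min_le_right a s.card)
  obtain ⟨Z, hZ₀Z, hZ⟩ := Finset.exists_superset_card_eq (s := Z₀) (by omega) ha
  have hrest : (s \ Z).card ≤ 2 * b := by
    have h₀ := Finset.card_sdiff_of_subset hZ₀s
    have h := Finset.card_le_card (Finset.sdiff_subset_sdiff (Finset.Subset.refl s) hZ₀Z)
    omega
  obtain ⟨T₁, hT₁s, hT₁⟩ := (s \ Z).exists_subset_card_eq (min_le_right b (s \ Z).card)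
  have hT₂ := Finset.card_sdiff_of_subset hT₁s
  refine ⟨Z, T₁, (s \ Z) \ T₁, hZ, by omega, by omega, Finset.disjoint_sdiff, fun i hi => ?_⟩
  simp only [Finset.mem_sdiff]
  tauto

variable {F : Type u} {n α : ℕ} {C : Scheme F n α} {D : Finset (Fin n)}

namespace Protocol

variable {p : Protocol C D} {zw : ℕ} {ε : ℝ} {T T₁ T₂ : Finset (Fin n)}

/-- The messages that the contacted parties send when no party is malicious. -/
def messages (p : Protocol C D) (w : Fin n → Fin α → F) : ∀ i : D, p.Msg i :=
  fun i => p.send i fun j => w i j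

/-- What the user receives when the secret and the shares are `a` but the parties in `T` pretend
that they are `a'`: the attack behind the converse. -/
def spoofed (p : Protocol C D) (T : Finset (Fin n)) (a a' : C.Secret × (Fin n → Fin α → F)) :
    ∀ i : D, p.Msg i :=
  p.received a.2 T (p.messages a'.2)

theorem spoofed_comm (hT : Disjoint T₁ T₂) {a a' : C.Secret × (Fin n → Fin α → F)}
    (h : ∀ i : D, (i : Fin n) ∉ T₁ → (i : Fin n) ∉ T₂ →
      p.messages a.2 i = p.messages a'.2 i) :
    p.spoofed T₁ a a' = p.spoofed T₂ a' a := by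
  funext i
  by_cases h₁ : (i : Fin n) ∈ T₁
  · simp only [spoofed, received, h₁, Finset.disjoint_left.1 hT h₁, if_true, if_false, messages]
  · by_cases h₂ : (i : Fin n) ∈ T₂
    · simp only [spoofed, received, h₁, h₂, if_true, if_false, messages]
    · simpa only [spoofed, received, messages, h₁, h₂, if_false] using h i h₁ h₂

theorem ErrorAtMost.toOuterMeasure_spoofed_le (hp : p.ErrorAtMost zw ε) (hT : T.card ≤ zw)
    (r : C.Secret × (Fin n → Fin α → F) → C.Secret × (Fin n → Fin α → F) → Prop) :
    (C.law.toOuterMeasure {a | ∃ a', r a a' ∧ p.decode (p.spoofed T a a') ≠ a.1}).toReal ≤ ε := by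
  classical
  have hforge : ∀ a, ∃ y, (∃ a', r a a' ∧ p.decode (p.spoofed T a a') ≠ a.1) →
      p.decode (p.received a.2 T y) ≠ a.1 := fun a => by
    by_cases h : ∃ a', r a a' ∧ p.decode (p.spoofed T a a') ≠ a.1
    · obtain ⟨a', -, ha'⟩ := h
      exact ⟨p.messages a'.2, fun _ => ha'⟩
    · exact ⟨p.messages a.2, fun h' => absurd h' h⟩
  choose forge hforge using hforge
  exact le_trans (ENNReal.toReal_mono (toOuterMeasure_ne_top _ _)
    (MeasureTheory.measure_mono fun a => hforge a)) (hp T hT forge)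

theorem ErrorAtMost.exists_guess (hp : p.ErrorAtMost zw ε) (hT : Disjoint T₁ T₂)
    (h₁ : T₁.card ≤ zw) (h₂ : T₂.card ≤ zw) {Y : Type*}
    {g : C.Secret × (Fin n → Fin α → F) → Y}
    (hg : ∀ a a', g a = g a' → ∀ i : D, (i : Fin n) ∉ T₁ → (i : Fin n) ∉ T₂ →
      p.messages a.2 i = p.messages a'.2 i) :
    ∃ guess : Y → C.Secret,
      (C.law.toOuterMeasure {a | a.1 ≠ guess (g a)}).toReal ≤ 2 * ε := by
  let bad T := {a | ∃ a', g a = g a' ∧ p.decode (p.spoofed T a a') ≠ a.1}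
  have : Nonempty C.Secret := ⟨C.law.support_nonempty.some.1⟩
  have hdecode : ∀ {T a a'}, a ∉ bad T → g a = g a' → p.decode (p.spoofed T a a') = a.1 :=
    fun ha h => by_contra fun hne => ha ⟨_, h, hne⟩
  obtain ⟨guess, hguess⟩ := exists_forall_eq_of_rel (f := Prod.fst)
    (R := fun y a => g a = y ∧ a ∉ bad T₁ ∧ a ∉ bad T₂) (by
      rintro _ a a' ⟨rfl, ha, -⟩ ⟨ha', -, ha'₂⟩
      rw [← hdecode ha ha'.symm, spoofed_comm hT (hg a a' ha'.symm), hdecode ha'₂ ha'])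
  have hsub : {a | a.1 ≠ guess (g a)} ⊆ bad T₁ ∪ bad T₂ := fun a ha => by
    by_contra hbad
    rw [Set.mem_union, not_or] at hbad
    exact ha (hguess _ a ⟨rfl, hbad⟩).symm
  have htop := toOuterMeasure_ne_top C.law
  refine ⟨guess, ?_⟩
  calc (C.law.toOuterMeasure {a | a.1 ≠ guess (g a)}).toReal
      ≤ (C.law.toOuterMeasure (bad T₁)).toReal + (C.law.toOuterMeasure (bad T₂)).toReal := by
        rw [← ENNReal.toReal_add (htop _) (htop _)]
        exact ENNReal.toReal_mono (ENNReal.add_ne_top.2 ⟨htop _, htop _⟩)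
          ((MeasureTheory.measure_mono hsub).trans (MeasureTheory.measure_union_le _ _))
    _ ≤ ε + ε := add_le_add (hp.toOuterMeasure_spoofed_le h₁ _) (hp.toOuterMeasure_spoofed_le h₂ _)
    _ = 2 * ε := (two_mul ε).symm

end Protocol

section Cost

variable [Fintype F] {k zr zw zro zwo zrw : ℕ}

theorem Scheme.plainDownload_readCost (C : Scheme F n α) (D : Finset (Fin n))
    (R : Finset (Fin α)) (dec : (D → R → F) → C.Secret) :
    (C.plainDownload D R dec).readCost = D.card * R.card := by
  simp [Protocol.readCost, plainDownload]

/-- The protocol in which the contacted parties send all symbols they read. -/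
def Protocol.sendAll (p : Protocol C D) : Protocol C D where
  read := p.read
  Msg := fun i => p.read i → F
  send := fun _ v => v
  decode := fun v => p.decode fun i => p.send i (v i)

theorem Protocol.decode_sendAll_received (p : Protocol C D) (w : Fin n → Fin α → F)
    (T : Finset (Fin n)) (y : ∀ i : D, p.read i → F) :
    p.sendAll.decode (p.sendAll.received w T y) =
      p.decode (p.received w T fun i => p.send i (y i)) := by
  refine congrArg p.decode (funext fun i => ?_)
  exact apply_ite (p.send i) ((i : Fin n) ∈ T) (y i) fun j => w i j

theorem Protocol.ErrorAtMost.sendAll {p : Protocol C D} {ε : ℝ} (hp : p.ErrorAtMost zw ε) :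
    p.sendAll.ErrorAtMost zw ε := by
  intro T hT forge
  have hsend : p.sendAll.errorProb T forge = p.errorProb T fun a i => p.send i (forge a i) :=
    congrArg (fun s => (C.law.toOuterMeasure s).toReal) <| Set.ext fun a =>
      not_congr (Eq.congr_left (p.decode_sendAll_received a.2 T (forge a)))
  exact hsend.trans_le (hp T hT _)

variable [Nontrivial F]

theorem one_lt_card_real (F : Type*) [Fintype F] [Nontrivial F] : (1 : ℝ) < Fintype.card F := by
  exact_mod_cast Fintype.one_lt_card

theorem logb_card_fun (ι : Type*) [Fintype ι] [Fintype (ι → F)] :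
    Real.logb (Fintype.card F) (Fintype.card (ι → F)) = Fintype.card ι := by
  have hcard : Fintype.card (ι → F) = Fintype.card F ^ Fintype.card ι := by
    simp only [← Nat.card_eq_fintype_card, Nat.card_fun]
  rw [hcard, Nat.cast_pow, Real.logb_pow, Real.logb_self_eq_one (one_lt_card_real F), mul_one]

theorem Scheme.IsResilient.exists_support (hC : C.IsResilient k) (hk : k ≤ n) :
    ∃ s : Finset C.Secret, (∀ a ∈ C.law.support, a.1 ∈ s) ∧
      s.card ≤ Fintype.card (Fin k → Fin α → F) := by
  classical
  obtain ⟨A, -, hA⟩ := (Finset.univ : Finset (Fin n)).exists_subset_card_eq (n := k) (by simpa)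
  have : Nonempty C.Secret := ⟨C.law.support_nonempty.some.1⟩
  obtain ⟨dec, hdec⟩ := exists_forall_eq_of_rel (f := Prod.fst)
    (R := fun y a => a ∈ C.law.support ∧ C.sharesOf A a = y) (by
      rintro _ a a' ⟨ha, rfl⟩ ⟨ha', h⟩
      exact (condEntropy_eq_zero_iff (one_lt_card_real F)).1 (hC A hA) a ha a' ha' h.symm)
  refine ⟨Finset.univ.image dec, fun a ha => ?_, ?_⟩
  · exact Finset.mem_image.2 ⟨_, Finset.mem_univ _, hdec _ a ⟨ha, rfl⟩⟩
  · refine Finset.card_image_le.trans_eq ?_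
    simp [hA]

theorem Protocol.size_le_sum_logb {p : Protocol C D} {ε : ℝ} (hk : k ≤ n) (hzr : zr ≤ n)
    (hpriv : C.IsPrivate zr) (hres : C.IsResilient k) (hε0 : 0 < ε) (hε1 : ε < 1 / 2)
    (hp : p.ErrorAtMost zw ε) {G : Finset D} (hG : D.card ≤ G.card + (zr + 2 * zw)) :
    C.size ≤ ∑ i ∈ G, Real.logb (Fintype.card F) (Fintype.card (p.Msg i)) +
      fanoBound (Fintype.card F) (Fintype.card (Fin k → Fin α → F)) (2 * ε) := by
  classical
  have hq := one_lt_card_real F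
  obtain ⟨a₀, -⟩ := C.law.support_nonempty
  have hGD : G.map (Function.Embedding.subtype (· ∈ D)) ⊆ D := Finset.map_subtype_subset G
  obtain ⟨Z, T₁, T₂, hZ, hT₁, hT₂, hdisj, hcover⟩ := exists_cover_of_card_le
    (s := D \ G.map (Function.Embedding.subtype (· ∈ D))) (a := zr) (b := zw) (by simpa) (by
      rw [Finset.card_sdiff_of_subset hGD, Finset.card_map]
      omega)
  let m : C.Secret × (Fin n → Fin α → F) → ∀ i : G, p.Msg i := fun a i => p.messages a.2 i
  obtain ⟨guess, hguess⟩ := hp.exists_guess hdisj hT₁ hT₂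
    (g := fun a => (C.sharesOf Z a, m a)) (by
      intro a a' h i hi₁ hi₂
      obtain ⟨hshares, hmsg⟩ := Prod.mk.inj h
      by_cases hiG : i ∈ G
      · exact congrFun hmsg ⟨i, hiG⟩
      · have hiZ : (i : Fin n) ∈ Z := by
          have := hcover i (by simp [hiG])
          tauto
        have hi : a.2 i = a'.2 i := congrFun hshares ⟨i, hiZ⟩
        simp only [messages, hi])
  obtain ⟨s, hs, hcard⟩ := hres.exists_support hk
  have hlogb : Real.logb (Fintype.card F) (Fintype.card (∀ i : G, p.Msg i)) =
      ∑ i ∈ G, Real.logb (Fintype.card F) (Fintype.card (p.Msg i)) := by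
    rw [Fintype.card_pi, Nat.cast_prod, Real.logb_prod _ _ fun i _ => ?_]
    · exact Finset.sum_coe_sort G fun i => Real.logb (Fintype.card F) (Fintype.card (p.Msg i))
    · exact_mod_cast (Fintype.card_pos_iff.2 ⟨p.messages a₀.2 i⟩).ne'
  calc C.size = condEntropy (Fintype.card F) C.law Prod.fst (C.sharesOf Z) := (hpriv Z hZ).symm
    _ ≤ Real.logb (Fintype.card F) (Fintype.card (∀ i : G, p.Msg i)) +
        condEntropy (Fintype.card F) C.law Prod.fst (fun a => (C.sharesOf Z a, m a)) :=
      condEntropy_le_logb_card_add hq C.law Prod.fst (C.sharesOf Z) m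
    _ ≤ _ := hlogb ▸ add_le_add_right
      (condEntropy_le_fanoBound hq hcard hs (by linarith) (by linarith) hguess) _

theorem card_mul_le_of_mem_commCosts (hk : k ≤ n) (hzr : zr ≤ n) {H κ : ℝ}
    (hκ : κ ∈ commCosts F n k zr zw α H D) :
    D.card * H ≤ (D.card - (zr + 2 * zw) : ℕ) * κ := by
  set m := D.card - (zr + 2 * zw) with hm
  set η : ℝ → ℝ := fun ε => fanoBound (Fintype.card F) (Fintype.card (Fin k → Fin α → F)) (2 * ε)
    with hη
  have hbound : ∀ ε, 0 < ε → ε < 1 / 2 → D.card * H ≤ m * κ + D.card * η ε := by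
    intro ε hε0 hε1
    obtain ⟨C, ⟨hpriv, hres, -⟩, hsize, p, hp, hcost⟩ := hκ ε hε0
    obtain ⟨G, -, hG, havg⟩ := exists_subset_card_mul_sum_le
      (fun i : D => Real.logb (Fintype.card F) (Fintype.card (p.Msg i))) (m := m) Finset.univ
      (by simp [hm])
    rw [Finset.card_univ, Fintype.card_coe] at havg
    have hle := hsize.trans
      (p.size_le_sum_logb hk hzr hpriv hres hε0 hε1 hp (G := G) (by omega))
    calc D.card * H ≤ D.card * (∑ i ∈ G,
          Real.logb (Fintype.card F) (Fintype.card (p.Msg i)) + η ε) := by gcongr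
      _ ≤ m * p.commCost + D.card * η ε := by rw [mul_add]; exact add_le_add_left havg _
      _ ≤ m * κ + D.card * η ε := by gcongr
  have hlim : Tendsto (fun ε => m * κ + D.card * η ε) (𝓝[>] 0) (𝓝 (m * κ)) := by
    have hmul : Tendsto (fun ε : ℝ => 2 * ε) (𝓝[>] 0) (𝓝 0) := by
      simpa using (tendsto_id.const_mul (2 : ℝ)).mono_left (nhdsWithin_le_nhds (a := (0 : ℝ)))
    simpa using (((tendsto_fanoBound _ _).comp hmul).const_mul (D.card : ℝ)).const_add (m * κ)
  refine ge_of_tendsto hlim ?_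
  filter_upwards [Ioo_mem_nhdsGT (by norm_num : (0 : ℝ) < 1 / 2)] with ε hε
  exact hbound ε hε.1 hε.2

theorem Scheme.plainDownload_commCost (C : Scheme F n α) (D : Finset (Fin n))
    (R : Finset (Fin α)) (dec : (D → R → F) → C.Secret) :
    (C.plainDownload D R dec).commCost = D.card * R.card := by
  have hlogb : ∀ i, Real.logb (Fintype.card F)
      (Fintype.card ((C.plainDownload D R dec).Msg i)) = R.card := fun _ =>
    (logb_card_fun R).trans (by rw [Fintype.card_coe])
  simp [Protocol.commCost, hlogb]

theorem omniscientCapacity_eq (k zro zwo zrw α : ℕ) :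
    omniscientCapacity k zro zwo zrw α =
      (k - (zro + zrw + 2 * (zwo + zrw)) : ℕ) * (α : ℝ) := by
  rw [omniscientCapacity]
  split_ifs with hc
  · rw [Nat.cast_sub (by omega)]
    push_cast
    ring
  · rw [Nat.sub_eq_zero_of_le (by omega), Nat.cast_zero, zero_mul]

theorem le_omniscientCapacity (hkn : k ≤ n) (hzr : zro + zrw < k) {H : ℝ}
    (hH : H ∈ achievableSizes F n k (zro + zrw) (zwo + zrw) α) :
    H ≤ omniscientCapacity k zro zwo zrw α := by
  obtain ⟨A, -, rfl⟩ := (Finset.univ : Finset (Fin n)).exists_subset_card_eq (n := k) (by simpa)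
  have hmem : (A.card * α : ℝ) ∈ commCosts F n A.card (zro + zrw) (zwo + zrw) α H A := by
    intro ε hε
    obtain ⟨C, hC, hsize⟩ := hH ε hε
    obtain ⟨dec, hdec⟩ := hC.2.2 A rfl
    exact ⟨C, hC, hsize, _, hdec, by simp [Scheme.plainDownload_commCost]⟩
  have hA : (0 : ℝ) < A.card := by exact_mod_cast (by omega : 0 < A.card)
  refine le_of_mul_le_mul_left ?_ hA
  rw [omniscientCapacity_eq, mul_left_comm]
  exact card_mul_le_of_mem_commCosts hkn (by omega) hmem

theorem optimalCost_eq {d : ℕ} (hc : zro + zrw + 2 * (zwo + zrw) < k) (hd : k ≤ d) :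
    optimalCost k zro zwo zrw α d = d * omniscientCapacity k zro zwo zrw α /
      (d - (zro + zrw + 2 * (zwo + zrw)) : ℕ) := by
  rw [optimalCost, omniscientCapacity_eq, Nat.cast_sub hc.le, Nat.cast_sub (hc.le.trans hd)]
  push_cast
  ring_nf

theorem optimalCost_mem_lowerBounds_commCosts (hkn : k ≤ n)
    (hc : 3 * zrw + 2 * zwo + zro < k) (hD : k ≤ D.card) :
    optimalCost k zro zwo zrw α D.card ∈ lowerBounds (commCosts F n k (zro + zrw) (zwo + zrw) α
      (omniscientCapacity k zro zwo zrw α) D) := by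
  intro κ hκ
  have hpos : 0 < D.card - (zro + zrw + 2 * (zwo + zrw)) := by omega
  rw [optimalCost_eq (by omega) hD, div_le_iff₀' (by exact_mod_cast hpos)]
  exact card_mul_le_of_mem_commCosts hkn (by omega) hκ

theorem Protocol.sendAll_commCost (p : Protocol C D) : p.sendAll.commCost = p.readCost :=
  Finset.sum_congr rfl fun i _ => (logb_card_fun (p.read i)).trans (by rw [Fintype.card_coe])

theorem readCosts_subset_commCosts (H : ℝ) :
    readCosts F n k zr zw α H D ⊆ commCosts F n k zr zw α H D := by
  intro κ hκ ε hε
  obtain ⟨C, hC, hsize, p, hp, hcost⟩ := hκ ε hε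
  exact ⟨C, hC, hsize, p.sendAll, hp.sendAll, p.sendAll_commCost.trans_le hcost⟩

end Cost

end Converse

section GroupScheme

theorem map_equiv_uniformOfFintype {V W : Type*} [Fintype V] [Nonempty V] [Fintype W] [Nonempty W]
    (e : V ≃ W) : (PMF.uniformOfFintype V).map e = PMF.uniformOfFintype W := by
  classical
  ext w
  obtain ⟨v, rfl⟩ := e.surjective w
  simp only [PMF.map_apply, e.injective.eq_iff, tsum_ite_eq', PMF.uniformOfFintype_apply,
    Fintype.card_congr e]

theorem prob_uniformOfFintype_eq_of_equivariant {V X : Type*} [Fintype V] [Nonempty V] {f : V → X}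
    (e : Equiv.Perm V) (e' : Equiv.Perm X) (h : ∀ v, f (e v) = e' (f v)) (x : X) :
    prob (PMF.uniformOfFintype V) f (e' x) = prob (PMF.uniformOfFintype V) f x := by
  rw [← prob_equiv_comp e' x, ← funext h]
  conv_lhs => rw [prob, ← map_equiv_uniformOfFintype e, PMF.map_comp]
  rfl

variable {F S : Type u} {V : Type*} {n α k zr zw : ℕ} {ε ε' : ℝ}

theorem Protocol.ErrorAtMost.mono {C : Scheme F n α} {D : Finset (Fin n)} {p : Protocol C D}
    (hp : p.ErrorAtMost zw ε) (h : ε ≤ ε') : p.ErrorAtMost zw ε' :=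
  fun T hT forge => (hp T hT forge).trans h

theorem Scheme.IsReliable.mono [Fintype F] {C : Scheme F n α} (hC : C.IsReliable k zr zw ε)
    (h : ε ≤ ε') : C.IsReliable k zr zw ε' :=
  ⟨hC.1, hC.2.1, fun A hA => (hC.2.2 A hA).imp fun _ hdec => hdec.mono h⟩

theorem Protocol.errorAtMost_zero {C : Scheme F n α} {D : Finset (Fin n)} {p : Protocol C D}
    (h : ∀ a ∈ C.law.support, ∀ T : Finset (Fin n), T.card ≤ zw → ∀ y,
      p.decode (p.received a.2 T y) = a.1) : p.ErrorAtMost zw 0 := by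
  intro T hT forge
  rw [errorProb, (PMF.toOuterMeasure_apply_eq_zero_iff _ _).2, ENNReal.toReal_zero]
  exact Set.disjoint_left.2 fun a ha hne => hne (h a ha T hT _)

variable [AddGroup F] [AddGroup S] [Fintype S] [AddGroup V] [Fintype V]

/-- The scheme whose secret and shares are the images of a uniformly random element of a finite
group under two homomorphisms; linear secret sharing schemes are of this form. -/
noncomputable abbrev groupScheme (sec : V →+ S) (sh : V →+ (Fin n → Fin α → F)) : Scheme F n α where
  Secret := S
  law := (PMF.uniformOfFintype V).map fun u => (sec u, sh u)

variable {sec : V →+ S} {sh : V →+ (Fin n → Fin α → F)}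

theorem mem_support_groupScheme_law {a : S × (Fin n → Fin α → F)} :
    a ∈ (groupScheme sec sh).law.support ↔ ∃ u, (sec u, sh u) = a := by
  rw [PMF.mem_support_map_iff]
  simp

theorem prob_groupScheme {X : Type*} (f : S × (Fin n → Fin α → F) → X) :
    prob (groupScheme sec sh).law f =
      prob (PMF.uniformOfFintype V) fun u => f (sec u, sh u) := by
  funext x
  rw [prob, PMF.map_comp]
  rfl

variable [Fintype F]

theorem groupScheme_exists_decoder (D : Finset (Fin n)) (R : Finset (Fin α))
    (h : ∀ E ⊆ D, D.card ≤ E.card + 2 * zw → ∀ u, (∀ i ∈ E, ∀ c ∈ R, sh u i c = 0) → sec u = 0) :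
    ∃ dec, ((groupScheme sec sh).plainDownload D R dec).ErrorAtMost zw 0 := by
  classical
  -- Two words within `zw` errors of the same received word agree outside `2 * zw` parties.
  obtain ⟨dec, hdec⟩ := exists_forall_eq_of_rel (f := sec)
    (R := fun (y : D → R → F) u => ∃ T : Finset (Fin n), T.card ≤ zw ∧
      ∀ i : D, (i : Fin n) ∉ T → ∀ c : R, y i c = sh u i c) (by
    rintro y u u' ⟨T, hT, hu⟩ ⟨T', hT', hu'⟩
    rw [← sub_eq_zero, ← map_sub]
    refine h (D \ (T ∪ T')) Finset.sdiff_subset ?_ _ fun i hi c hc => ?_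
    · have hunion := Finset.card_union_le T T'
      have hsdiff := Finset.le_card_sdiff (T ∪ T') D
      omega
    · simp only [Finset.mem_sdiff, Finset.mem_union, not_or] at hi
      rw [map_sub, Pi.sub_apply, Pi.sub_apply, sub_eq_zero]
      exact (hu ⟨i, hi.1⟩ hi.2.1 ⟨c, hc⟩).symm.trans (hu' ⟨i, hi.1⟩ hi.2.2 ⟨c, hc⟩))
  refine ⟨dec, Protocol.errorAtMost_zero fun a ha T hT y => ?_⟩
  obtain ⟨u, rfl⟩ := mem_support_groupScheme_law.1 ha
  exact hdec _ u ⟨T, hT, fun i hi c => congrFun (if_neg hi) c⟩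

theorem groupScheme_size (hsec : Function.Surjective sec) :
    (groupScheme sec sh).size = Real.logb (Fintype.card F) (Fintype.card S) := by
  refine entropy_eq_logb_card fun s s' => ?_
  obtain ⟨u, hu⟩ := hsec (-s' + s)
  rw [prob_groupScheme, ← prob_uniformOfFintype_eq_of_equivariant (Equiv.addRight u)
    (Equiv.addRight (-s' + s)) (fun v => by simp [hu, add_assoc]) s']
  simp

theorem groupScheme_isPrivate (hsec : Function.Surjective sec)
    (h : ∀ Z : Finset (Fin n), Z.card = zr → ∀ s, ∃ u, sec u = s ∧ ∀ i ∈ Z, sh u i = 0) :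
    (groupScheme sec sh).IsPrivate zr := by
  intro Z hZ
  refine (condEntropy_eq_logb_card fun s s' y => ?_).trans (groupScheme_size hsec).symm
  obtain ⟨u, hu, hu0⟩ := h Z hZ (-s' + s)
  rw [prob_groupScheme, ← prob_uniformOfFintype_eq_of_equivariant (Equiv.addRight u)
    ((Equiv.addRight (-s' + s)).prodCongr (Equiv.refl _)) (fun v => Prod.ext ?_ ?_) (s', y)]
  · simp
  · simp [hu]
  · funext i
    simp [Scheme.sharesOf, hu0 i i.2]

theorem groupScheme_isResilient [Nontrivial F]
    (h : ∀ A : Finset (Fin n), A.card = k → ∀ u, (∀ i ∈ A, sh u i = 0) → sec u = 0) :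
    (groupScheme sec sh).IsResilient k := by
  intro A hA
  rw [condEntropy_eq_zero_iff (one_lt_card_real F)]
  intro a ha a' ha' haa'
  obtain ⟨u, rfl⟩ := mem_support_groupScheme_law.1 ha
  obtain ⟨u', rfl⟩ := mem_support_groupScheme_law.1 ha'
  refine (sub_eq_zero (G := S)).1 ?_
  rw [← map_sub]
  refine h A hA _ fun i hi => ?_
  rw [map_sub, Pi.sub_apply, sub_eq_zero]
  exact congrFun haa' ⟨i, hi⟩

end GroupScheme

section Blocks

variable {t z α e e' r c N : ℕ}

theorem stairWidth_self (hz : z < t) : stairWidth t z α t = α :=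
  Nat.mul_div_cancel_left α (Nat.sub_pos_of_lt hz)

theorem stairWidth_anti (hz : z < e) (h : e ≤ e') :
    stairWidth t z α e' ≤ stairWidth t z α e :=
  Nat.div_le_div_left (Nat.sub_le_sub_right h z) (Nat.sub_pos_of_lt hz)

theorem stairWidth_le (hz : z < t) (he : t ≤ e) : stairWidth t z α e ≤ α :=
  (stairWidth_anti hz he).trans (stairWidth_self hz).le

theorem sub_mul_stairWidth (h : (e - z) ∣ (t - z) * α) :
    (e - z) * stairWidth t z α e = (t - z) * α :=
  Nat.mul_div_cancel' h

theorem sub_mul_stairWidth_sub (hz : z ≤ e) (h : (e - z) ∣ (t - z) * α)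
    (h' : (e + 1 - z) ∣ (t - z) * α) :
    (e - z) * (stairWidth t z α e - stairWidth t z α (e + 1)) = stairWidth t z α (e + 1) := by
  rw [Nat.mul_sub, sub_mul_stairWidth h, ← sub_mul_stairWidth h', Nat.sub_add_comm hz,
    add_one_mul, Nat.add_sub_cancel_left]

/-- Column `c` of a staircase matrix belongs to the block `M_e`, not the first one. -/
def InBlock (t z α e c : ℕ) : Prop :=
  stairWidth t z α (e + 1) ≤ c ∧ c < stairWidth t z α e

/-- The column `l` such that the entry in row `e` and column `l` of a staircase matrix is copied to
row `r` and column `c`, for a column `c` of the block `M_e`. -/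
def copySource (t z α e r c : ℕ) : ℕ :=
  r * (stairWidth t z α e - stairWidth t z α (e + 1)) + (c - stairWidth t z α (e + 1))

theorem InBlock.unique (hz : z ≤ e) (hz' : z ≤ e') (h : InBlock t z α e c)
    (h' : InBlock t z α e' c) : e = e' := by
  by_contra hne
  rcases lt_or_gt_of_ne hne with hlt | hlt
  · exact (h.1.trans_lt h'.2).not_ge (stairWidth_anti (Nat.lt_succ_of_le hz) hlt)
  · exact (h'.1.trans_lt h.2).not_ge (stairWidth_anti (Nat.lt_succ_of_le hz') hlt)

theorem exists_inBlock (heN : e ≤ N) (hN : stairWidth t z α N ≤ c) (he : c < stairWidth t z α e) :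
    ∃ m, e ≤ m ∧ m < N ∧ InBlock t z α m c := by
  induction N, heN using Nat.le_induction with
  | base => exact absurd hN he.not_ge
  | succ N heN ih =>
    rcases le_or_gt (stairWidth t z α N) c with h | h
    · obtain ⟨m, hem, hmN, hm⟩ := ih h
      exact ⟨m, hem, hmN.trans N.lt_succ_self, hm⟩
    · exact ⟨N, heN, N.lt_succ_self, hN, h⟩

theorem copySource_lt (h : (e - z) ∣ (t - z) * α) (h' : (e + 1 - z) ∣ (t - z) * α)
    (hr : r + z < e) (hc : InBlock t z α e c) :
    copySource t z α e r c < stairWidth t z α (e + 1) := by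
  have hwidth := sub_mul_stairWidth_sub (by omega) h h'
  have hrow : (r + 1) * (stairWidth t z α e - stairWidth t z α (e + 1)) ≤
      (e - z) * (stairWidth t z α e - stairWidth t z α (e + 1)) :=
    Nat.mul_le_mul_right _ (by omega)
  rw [add_one_mul] at hrow
  have hc₁ := hc.1
  have hc₂ := hc.2
  rw [copySource]
  omega

theorem exists_copySource_eq (hz : z ≤ e) (h : (e - z) ∣ (t - z) * α)
    (h' : (e + 1 - z) ∣ (t - z) * α) (hc : c < stairWidth t z α (e + 1)) :
    ∃ r c', r + z < e ∧ InBlock t z α e c' ∧ copySource t z α e r c' = c := by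
  have hwidth := sub_mul_stairWidth_sub hz h h'
  set w := stairWidth t z α e - stairWidth t z α (e + 1) with hw
  have hwpos : 0 < w := Nat.pos_of_mul_pos_left (by omega : 0 < (e - z) * w)
  have hdiv : c / w < e - z := by rwa [Nat.div_lt_iff_lt_mul hwpos, hwidth]
  have hmod : c % w < w := Nat.mod_lt c hwpos
  refine ⟨c / w, stairWidth t z α (e + 1) + c % w, by omega, ⟨by omega, by omega⟩, ?_⟩
  rw [copySource, ← hw, Nat.add_sub_cancel_left, Nat.div_add_mod']

end Blocks

section Layout

variable {F : Type u} {n t z N α : ℕ} {ρ : Fin N → Fin N}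

/-- The conditions that a staircase matrix with columns `f`, in which the copied symbols of each
block are placed in the rows given by `ρ`, imposes on its column `c`, called `v`. Staircase codes
have `ρ = id`. -/
structure IsLayoutColumn [Zero F] (ρ : Fin N → Fin N) (t z : ℕ) (f : Fin α → Fin N → F)
    (c : Fin α) (v : Fin N → F) : Prop where
  copy : ∀ (e r : Fin N) (l : Fin α), t ≤ (e : ℕ) → InBlock t z α e c → (r : ℕ) + z < e →
    (l : ℕ) = copySource t z α e r c → v (ρ r) = f l e
  zero : ∀ e r : Fin N, t ≤ (e : ℕ) → InBlock t z α e c → e ≤ r → v r = 0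

/-- The staircase matrices in which the copied symbols of each block are placed in the rows given
by `ρ`. -/
def IsStaircaseLayout [Zero F] (ρ : Fin N → Fin N) (t z : ℕ) (M : Matrix (Fin N) (Fin α) F) :
    Prop :=
  ∀ c, IsLayoutColumn ρ t z M.transpose c (M.transpose c)

theorem isStaircaseMatrix_iff [Zero F] {M : Matrix (Fin N) (Fin α) F} :
    IsStaircaseMatrix t z N α M ↔ IsStaircaseLayout id t z M :=
  ⟨fun h c => ⟨fun e r l he hc hr hl => h.copy e r c l he hc.1 hc.2 hr hl,
      fun e r he hc hr => h.zero e r c he hc.1 hc.2 hr⟩,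
    fun h => ⟨fun e r c l he hc hc' hr hl => (h c).copy e r l he ⟨hc, hc'⟩ hr hl,
      fun e r c he hc hc' hr => (h c).zero e r he ⟨hc, hc'⟩ hr⟩⟩

theorem IsLayoutColumn.congr [Zero F] (hdiv : ∀ e, t ≤ e → e ≤ N → (e - z) ∣ (t - z) * α)
    {f g : Fin α → Fin N → F} {c : Fin α} {v : Fin N → F} (h : IsLayoutColumn ρ t z f c v)
    (hfg : ∀ l < c, f l = g l) : IsLayoutColumn ρ t z g c v where
  copy e r l he hc hr hl := by
    have hlt := copySource_lt (hdiv e he e.2.le) (hdiv (e + 1) (by omega) e.2) hr hc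
    rw [← hfg l (Fin.lt_def.2 (hl ▸ hlt.trans_le hc.1)), h.copy e r l he hc hr hl]
  zero := h.zero

variable (F) in
/-- The group of the staircase matrices with a given layout. -/
def layoutSubgroup [AddGroup F] (ρ : Fin N → Fin N) (t z α : ℕ) :
    AddSubgroup (Matrix (Fin N) (Fin α) F) where
  carrier := {M | IsStaircaseLayout ρ t z M}
  zero_mem' _ := ⟨fun _ _ _ _ _ _ _ => rfl, fun _ _ _ _ _ => rfl⟩
  add_mem' hA hB c :=
    ⟨fun e r l he hc hr hl =>
        congrArg₂ (· + ·) ((hA c).copy e r l he hc hr hl) ((hB c).copy e r l he hc hr hl),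
      fun e r he hc hr => (congrArg₂ (· + ·) ((hA c).zero e r he hc hr)
        ((hB c).zero e r he hc hr)).trans (add_zero 0)⟩
  neg_mem' hA c :=
    ⟨fun e r l he hc hr hl => congrArg Neg.neg ((hA c).copy e r l he hc hr hl),
      fun e r he hc hr => (congrArg Neg.neg ((hA c).zero e r he hc hr)).trans neg_zero⟩

variable [Ring F] {V : Matrix (Fin n) (Fin N) F}

/-- The properties of an encoding matrix `V` that make a Staircase code with layout `ρ` decodable
and private: a vector supported on the first `m` rows vanishes if it encodes to zero at `m` parties,
and the data of any block can be completed to a vector that encodes to zero at `z` parties. -/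
structure IsStaircaseEncoder (V : Matrix (Fin n) (Fin N) F) (ρ : Fin N → Fin N) (t z : ℕ) :
    Prop where
  eq_zero : ∀ (E : Finset (Fin n)) (v : Fin N → F), (∀ r : Fin N, E.card ≤ r → v r = 0) →
    (∀ i ∈ E, V.mulVec v i = 0) → v = 0
  exists_completion : ∀ Z : Finset (Fin n), Z.card = z → ∀ e, t ≤ e → e ≤ N →
    ∀ data : Fin N → F, ∃ v : Fin N → F, (∀ r : Fin N, (r : ℕ) + z < e → v (ρ r) = data r) ∧
      (∀ r : Fin N, e ≤ r → v r = 0) ∧ ∀ i ∈ Z, V.mulVec v i = 0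

theorem IsStaircaseLayout.eq_zero (hz : z < t)
    (hdiv : ∀ e, t ≤ e → e ≤ N → (e - z) ∣ (t - z) * α) (hV : IsStaircaseEncoder V ρ t z)
    {M : Matrix (Fin N) (Fin α) F} (hM : IsStaircaseLayout ρ t z M) {E : Finset (Fin n)}
    (hE : t ≤ E.card)
    (h : ∀ i ∈ E, ∀ c : Fin α, (c : ℕ) < stairWidth t z α E.card → (V * M) i c = 0)
    {c : Fin α} (hc : (c : ℕ) < stairWidth t z α E.card) (r : Fin N) : M r c = 0 := by
  have column_eq_zero : ∀ c : Fin α, (c : ℕ) < stairWidth t z α E.card →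
      (∀ r : Fin N, E.card ≤ r → M r c = 0) → ∀ r, M r c = 0 := fun c hc hrows =>
    congrFun (hV.eq_zero E (M.transpose c) hrows fun i hi => h i hi c hc)
  have below_eq_zero : ∀ (r : Fin N) (c : Fin α), E.card ≤ (r : ℕ) →
      (c : ℕ) < stairWidth t z α E.card → stairWidth t z α (r + 1) ≤ c → M r c = 0 := by
    intro r c hr hc hrc
    obtain ⟨e, hEe, her, he⟩ := exists_inBlock (by omega) hrc hc
    exact (hM c).zero ⟨e, by omega⟩ r (hE.trans hEe) he (Fin.le_def.2 (Nat.le_of_lt_succ her))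
  refine column_eq_zero c hc (fun r => ?_) r
  induction r using WellFoundedLT.induction generalizing c with
  | _ r ih =>
  intro hr
  rcases le_or_gt (stairWidth t z α (r + 1)) c with hrc | hrc
  · exact below_eq_zero r c hr hc hrc
  -- Otherwise the entry is copied to block `M_r`, whose column vanishes by induction.
  obtain ⟨r', c', hr', hc', hcopy⟩ := exists_copySource_eq (by omega)
    (hdiv r (hE.trans hr) r.2.le) (hdiv (r + 1) (by omega) r.2) hrc
  have hle : stairWidth t z α r ≤ stairWidth t z α E.card := stairWidth_anti (by omega) hr
  have hcα : c' < α := hc'.2.trans_le (stairWidth_le hz (hE.trans hr))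
  have copied : M (ρ ⟨r', by omega⟩) ⟨c', hcα⟩ = M r c :=
    (hM ⟨c', hcα⟩).copy r _ c (hE.trans hr) hc' hr' hcopy.symm
  rw [← copied]
  refine column_eq_zero _ (hc'.2.trans_le hle) (fun s hs => ?_) _
  rcases lt_or_ge s r with hsr | hsr
  · exact ih s hsr (hc'.2.trans_le hle) hs
  · exact (hM ⟨c', hcα⟩).zero r s (hE.trans hr) hc' hsr

theorem exists_forall_of_forall_lt {ι β : Type*} [LT ι] [WellFoundedLT ι] [Nonempty β]
    {R : (ι → β) → ι → β → Prop} (hR : ∀ f i, ∃ v, R f i v)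
    (hcongr : ∀ f g i v, (∀ j < i, f j = g j) → R f i v → R g i v) :
    ∃ f : ι → β, ∀ i, R f i (f i) := by
  classical
  choose next hnext using hR
  let step (i : ι) (f : ∀ j, j < i → β) : β :=
    next (fun j => if hj : j < i then f j hj else Classical.arbitrary β) i
  refine ⟨wellFounded_lt.fix step, fun i => ?_⟩
  rw [wellFounded_lt.fix_eq]
  exact hcongr _ _ i _ (fun j hj => dif_pos hj) (hnext _ i)

theorem IsStaircaseEncoder.exists_layoutColumn (hV : IsStaircaseEncoder V ρ t z) (hz : z < t)
    (htN : t ≤ N) {Z : Finset (Fin n)} (hZ : Z.card = z) (s : Fin N → F)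
    (f : Fin α → Fin N → F) (c : Fin α) :
    ∃ v, IsLayoutColumn ρ t z f c v ∧
      ((c : ℕ) < stairWidth t z α N → ∀ r : Fin N, (r : ℕ) + z < N → v (ρ r) = s r) ∧
      ∀ i ∈ Z, V.mulVec v i = 0 := by
  rcases lt_or_ge (c : ℕ) (stairWidth t z α N) with hc | hc
  · have not_inBlock : ∀ e : Fin N, t ≤ (e : ℕ) → ¬ InBlock t z α e c := fun e he hec =>
      (hec.1.trans_lt hc).not_ge (stairWidth_anti (by omega) e.2)
    obtain ⟨v, hdata, -, hVv⟩ := hV.exists_completion Z hZ N htN le_rfl s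
    exact ⟨v, ⟨fun e _ _ he hec => absurd hec (not_inBlock e he),
      fun e _ he hec => absurd hec (not_inBlock e he)⟩, fun _ => hdata, hVv⟩
  · obtain ⟨e, hte, heN, hec⟩ := exists_inBlock htN hc (c.2.trans_eq (stairWidth_self hz).symm)
    have eq_of_inBlock : ∀ e' : Fin N, t ≤ (e' : ℕ) → InBlock t z α e' c → e' = ⟨e, heN⟩ :=
      fun e' he' hec' => Fin.ext (InBlock.unique (e' := e) (by omega) (by omega) hec' hec)
    obtain ⟨v, hdata, hzero, hVv⟩ := hV.exists_completion Z hZ e hte heN.le fun r =>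
      if hl : copySource t z α e r c < α then f ⟨_, hl⟩ ⟨e, heN⟩ else 0
    refine ⟨v, ⟨fun e' r l he' hec' hr hl => ?_, fun e' r he' hec' hr => ?_⟩,
      fun hc' => absurd hc hc'.not_ge, hVv⟩
    · obtain rfl := eq_of_inBlock e' he' hec'
      rw [hdata r hr, dif_pos (hl ▸ l.2)]
      exact congrArg (f · _) (Fin.ext hl.symm)
    · obtain rfl := eq_of_inBlock e' he' hec'
      exact hzero r hr

theorem IsStaircaseEncoder.exists_layout (hV : IsStaircaseEncoder V ρ t z) (hz : z < t)
    (htN : t ≤ N) (hdiv : ∀ e, t ≤ e → e ≤ N → (e - z) ∣ (t - z) * α) {Z : Finset (Fin n)}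
    (hZ : Z.card = z) (s : Fin N → Fin α → F) :
    ∃ M : Matrix (Fin N) (Fin α) F, IsStaircaseLayout ρ t z M ∧
      (∀ (r : Fin N) (c : Fin α), (r : ℕ) + z < N → (c : ℕ) < stairWidth t z α N →
        M (ρ r) c = s r c) ∧
      ∀ i ∈ Z, (V * M) i = 0 := by
  obtain ⟨f, hf⟩ := exists_forall_of_forall_lt
    (fun f c => hV.exists_layoutColumn hz htN hZ (fun r => s r c) f c)
    (fun f g c v hfg hv => ⟨hv.1.congr hdiv hfg, hv.2⟩)
  exact ⟨(Matrix.of f).transpose, fun c => (hf c).1, fun r c hr hc => (hf c).2.1 hc r hr,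
    fun i hi => funext fun c => (hf c).2.2 i hi⟩

end Layout

section Vandermonde

open Polynomial

variable {F : Type u} [Field F] {n t z N α : ℕ} {ρ : Fin N → Fin N} {x : Fin n → F}

theorem rectVandermonde_mulVec_coeff (x : Fin n → F) {p : F[X]} (hp : p.degree < N) (i : Fin n) :
    (Matrix.rectVandermonde x 1 N).mulVec (fun r => p.coeff r) i = p.eval (x i) := by
  rw [eval_eq_sum, ← sum_fin (fun e a => a * x i ^ e) (fun _ => zero_mul _) hp]
  simp only [Matrix.mulVec, dotProduct, Matrix.rectVandermonde_apply, Pi.one_apply, one_pow,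
    mul_one, mul_comm]

theorem eq_zero_of_rectVandermonde_mulVec_eq_zero {E : Finset (Fin n)} (hx : Set.InjOn x E)
    {v : Fin N → F} (hv : ∀ r : Fin N, E.card ≤ r → v r = 0)
    (h : ∀ i ∈ E, (Matrix.rectVandermonde x 1 N).mulVec v i = 0) : v = 0 := by
  classical
  have hcoeff : v = fun r : Fin N => (ofFn N v).coeff r :=
    funext fun r => (ofFn_coeff_eq_val_of_lt v r.2).symm
  have hdeg : (ofFn N v).degree < E.card := by
    rw [degree_lt_iff_coeff_zero]
    intro m hm
    rcases lt_or_ge m N with hmN | hmN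
    · exact (ofFn_coeff_eq_val_of_lt v hmN).trans (hv ⟨m, hmN⟩ hm)
    · exact ofFn_coeff_eq_zero_of_ge v hmN
  have hzero : ofFn N v = 0 := eq_zero_of_degree_lt_of_eval_index_eq_zero E hx hdeg fun i hi => by
    rw [← rectVandermonde_mulVec_coeff x (ofFn_degree_lt v), ← hcoeff, h i hi]
  rw [hcoeff, hzero]
  rfl

theorem exists_coeff_eq_and_eval_eq_zero {ι : Type*} {x : ι → F} {Z : Finset ι}
    (hx : Set.InjOn x Z) {o : ℕ} (ho : ∀ i ∈ Z, x i ^ o ≠ 0) (p : F[X]) :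
    ∃ q : F[X], (∀ r, r < o ∨ o + Z.card ≤ r → q.coeff r = p.coeff r) ∧
      ∀ i ∈ Z, q.eval (x i) = 0 := by
  classical
  let g : F[X] := Lagrange.interpolate Z x fun i => -p.eval (x i) / x i ^ o
  refine ⟨p + X ^ o * g, fun r hr => ?_, fun i hi => ?_⟩
  · rw [coeff_add, coeff_X_pow_mul', add_eq_left]
    split_ifs with hor
    · refine coeff_eq_zero_of_degree_lt ((Lagrange.degree_interpolate_lt _ hx).trans_le ?_)
      exact_mod_cast (by omega : Z.card ≤ r - o)
    · rfl
  · rw [eval_add, eval_mul, eval_pow, eval_X, Lagrange.eval_interpolate_at_node _ hx hi,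
      mul_div_cancel₀ _ (ho i hi), add_neg_cancel]

theorem isStaircaseEncoder_rectVandermonde (hx : Function.Injective x)
    (hρ : Function.Injective ρ) (o : ℕ → ℕ) (hox : ∀ e i, x i ^ o e ≠ 0)
    (hoz : ∀ e, t ≤ e → o e + z ≤ e)
    (hoρ : ∀ (e : ℕ) (r : Fin N), r + z < e → e ≤ N →
      (ρ r : ℕ) < e ∧ ((ρ r : ℕ) < o e ∨ o e + z ≤ ρ r)) :
    IsStaircaseEncoder (Matrix.rectVandermonde x 1 N) ρ t z where
  eq_zero _ _ := eq_zero_of_rectVandermonde_mulVec_eq_zero hx.injOn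
  exists_completion Z hZ e hte heN data := by
    classical
    let b : Fin N → F := fun r => if (r : ℕ) < e then Function.extend ρ data 0 r else 0
    obtain ⟨q, hq, hqZ⟩ := exists_coeff_eq_and_eval_eq_zero (Z := Z) hx.injOn
      (fun i _ => hox e i) (ofFn N b)
    rw [hZ] at hq
    have hqb : ∀ r : Fin N, (r : ℕ) < o e ∨ o e + z ≤ r → q.coeff r = b r := fun r hr =>
      (hq r hr).trans (ofFn_coeff_eq_val_of_lt b r.2)
    have hdeg : q.degree < N := by
      rw [degree_lt_iff_coeff_zero]
      intro m hm
      rw [hq m (Or.inr ((hoz e hte).trans (heN.trans hm))), ofFn_coeff_eq_zero_of_ge b hm]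
    refine ⟨fun r => q.coeff r, fun r hr => ?_, fun r hr => ?_, fun i hi => ?_⟩
    · obtain ⟨hre, hro⟩ := hoρ e r hr heN
      exact (hqb _ hro).trans ((if_pos hre).trans (hρ.extend_apply data 0 r))
    · exact (hqb r (Or.inr ((hoz e hte).trans hr))).trans (if_neg hr.not_gt)
    · rw [rectVandermonde_mulVec_coeff x hdeg, hqZ i hi]

theorem isStaircaseEncoder_id (hx : Function.Injective x) (hx₀ : ∀ i, x i ≠ 0) (hz : z ≤ t) :
    IsStaircaseEncoder (Matrix.rectVandermonde x 1 N) id t z :=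
  isStaircaseEncoder_rectVandermonde hx Function.injective_id (fun e => e - z)
    (fun _ i => pow_ne_zero _ (hx₀ i)) (fun e he => by omega)
    (fun e r hr _ => by rw [id]; omega)

/-- The layout that places the random symbols of each block above its data. With it the Staircase
construction is private for any distinct evaluation points, one of which may be zero; this matters
when the field has only `n` elements. -/
def rotateRows (N z : ℕ) (r : Fin N) : Fin N :=
  ⟨(r + z) % N, Nat.mod_lt _ r.pos⟩

theorem rotateRows_injective (N z : ℕ) : Function.Injective (rotateRows N z) := fun r s h =>
  Fin.ext ((Nat.ModEq.add_right_cancel' z (Fin.ext_iff.1 h)).eq_of_lt_of_lt r.2 s.2)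

theorem isStaircaseEncoder_rotateRows (hx : Function.Injective x) (hz : z ≤ t) :
    IsStaircaseEncoder (Matrix.rectVandermonde x 1 N) (rotateRows N z) t z := by
  refine isStaircaseEncoder_rectVandermonde hx (rotateRows_injective N z) 0
    (fun _ i => by simp) (fun e he => by simpa using hz.trans he) fun e r hr heN => ?_
  have hval : (rotateRows N z r : ℕ) = r + z := Nat.mod_eq_of_lt (hr.trans_le heN)
  simp only [hval, Pi.zero_apply]
  omega

end Vandermonde

section StaircaseScheme

variable {F : Type u} {n t z zw N α : ℕ} {ρ : Fin N → Fin N}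

/-- The secret symbols in a staircase matrix with layout `ρ`. -/
def layoutSecret [AddZeroClass F] (ρ : Fin N → Fin N) (t z α : ℕ) :
    Matrix (Fin N) (Fin α) F →+
      ({p : Fin N × Fin α // (p.1 : ℕ) + z < N ∧ (p.2 : ℕ) < stairWidth t z α N} → F) where
  toFun M p := M (ρ p.1.1) p.1.2
  map_zero' := rfl
  map_add' _ _ := rfl

/-- The shares that the encoding matrix `V` assigns to a message matrix. -/
def encodedShares [NonUnitalNonAssocSemiring F] (V : Matrix (Fin n) (Fin N) F) (α : ℕ) :
    Matrix (Fin N) (Fin α) F →+ (Fin n → Fin α → F) where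
  toFun M := V * M
  map_zero' := Matrix.mul_zero V
  map_add' := Matrix.mul_add V

theorem card_layoutSecret_index (hz : z < t) (htN : t ≤ N)
    (hdiv : (N - z) ∣ (t - z) * α) :
    Fintype.card {p : Fin N × Fin α // (p.1 : ℕ) + z < N ∧ (p.2 : ℕ) < stairWidth t z α N} =
      (t - z) * α := by
  have hfilter : (Finset.univ.filter fun p : Fin N × Fin α =>
      (p.1 : ℕ) + z < N ∧ (p.2 : ℕ) < stairWidth t z α N) =
        (Finset.univ.filter fun r : Fin N => (r : ℕ) < N - z) ×ˢ
          Finset.univ.filter fun c : Fin α => (c : ℕ) < stairWidth t z α N := by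
    ext p
    simp only [Finset.mem_filter, Finset.mem_univ, true_and, Finset.mem_product,
      Nat.lt_sub_iff_add_lt]
  rw [Fintype.card_subtype, hfilter, Finset.card_product, Fin.card_filter_val_lt,
    Fin.card_filter_val_lt, min_eq_right (Nat.sub_le N z), min_eq_right (stairWidth_le hz htN),
    sub_mul_stairWidth hdiv]

variable [Ring F] {V : Matrix (Fin n) (Fin N) F}

theorem layoutSecret_eq_zero (hz : z < t) (hdiv : ∀ e, t ≤ e → e ≤ N → (e - z) ∣ (t - z) * α)
    (hV : IsStaircaseEncoder V ρ t z) {E : Finset (Fin n)} {e : ℕ} (hte : t ≤ e) (heN : e ≤ N)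
    (hE : e ≤ E.card) {M : Matrix (Fin N) (Fin α) F} (hM : IsStaircaseLayout ρ t z M)
    (h : ∀ i ∈ E, ∀ c : Fin α, (c : ℕ) < stairWidth t z α e → encodedShares V α M i c = 0) :
    layoutSecret ρ t z α M = 0 := by
  obtain ⟨E', hE', rfl⟩ := Finset.exists_subset_card_eq hE
  exact funext fun p => hM.eq_zero hz hdiv hV hte (fun i hi => h i (hE' hi))
    (p.2.2.trans_le (stairWidth_anti (hz.trans_le hte) heN)) _

theorem exists_layoutSecret_eq (hz : z < t) (htN : t ≤ N)
    (hdiv : ∀ e, t ≤ e → e ≤ N → (e - z) ∣ (t - z) * α) (hV : IsStaircaseEncoder V ρ t z)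
    {Z : Finset (Fin n)} (hZ : Z.card = z)
    (s : {p : Fin N × Fin α // (p.1 : ℕ) + z < N ∧ (p.2 : ℕ) < stairWidth t z α N} → F) :
    ∃ M : layoutSubgroup F ρ t z α,
      layoutSecret ρ t z α M.1 = s ∧ ∀ i ∈ Z, encodedShares V α M.1 i = 0 := by
  classical
  obtain ⟨M, hM, hsecret, hZM⟩ := hV.exists_layout hz htN hdiv hZ fun r c =>
    if h : (r : ℕ) + z < N ∧ (c : ℕ) < stairWidth t z α N then s ⟨(r, c), h⟩ else 0
  exact ⟨⟨M, hM⟩, funext fun p => (hsecret _ _ p.2.1 p.2.2).trans (dif_pos p.2), hZM⟩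

theorem layoutSecret_surjective (hz : z < t) (htN : t ≤ N) (hzn : z ≤ n)
    (hdiv : ∀ e, t ≤ e → e ≤ N → (e - z) ∣ (t - z) * α) (hV : IsStaircaseEncoder V ρ t z) :
    Function.Surjective
      ((layoutSecret ρ t z α).comp (layoutSubgroup F ρ t z α).subtype) := fun s =>
  have ⟨_, _, hZ⟩ := (Finset.univ : Finset (Fin n)).exists_subset_card_eq (n := z) (by simpa)
  (exists_layoutSecret_eq hz htN hdiv hV hZ s).imp fun _ h => h.1

variable [Fintype F]

noncomputable instance : Fintype (layoutSubgroup F ρ t z α) :=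
  Fintype.ofFinite _

/-- The Staircase code with layout `ρ` and encoding matrix `V`. -/
noncomputable abbrev layoutScheme (V : Matrix (Fin n) (Fin N) F) (ρ : Fin N → Fin N)
    (t z α : ℕ) : Scheme F n α :=
  groupScheme ((layoutSecret ρ t z α).comp (layoutSubgroup F ρ t z α).subtype)
    ((encodedShares V α).comp (layoutSubgroup F ρ t z α).subtype)

theorem layoutScheme_exists_decoder (hz : z < t)
    (hdiv : ∀ e, t ≤ e → e ≤ N → (e - z) ∣ (t - z) * α) (hV : IsStaircaseEncoder V ρ t z)
    {D : Finset (Fin n)} {e : ℕ} (hte : t ≤ e) (heN : e ≤ N) (hD : e + 2 * zw ≤ D.card) :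
    ∃ dec, ((layoutScheme V ρ t z α).plainDownload D
      (Finset.univ.filter fun c : Fin α => (c : ℕ) < stairWidth t z α e) dec).ErrorAtMost zw 0 :=
  groupScheme_exists_decoder D _ fun _ _ hE M h =>
    layoutSecret_eq_zero hz hdiv hV hte heN (by omega) M.2 fun i hi c hc =>
      h i hi c (by simpa using hc)

variable [Nontrivial F]

theorem layoutScheme_size (hz : z < t) (htN : t ≤ N) (hzn : z ≤ n)
    (hdiv : ∀ e, t ≤ e → e ≤ N → (e - z) ∣ (t - z) * α) (hV : IsStaircaseEncoder V ρ t z) :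
    (layoutScheme V ρ t z α).size = (t - z : ℕ) * α := by
  rw [groupScheme_size (layoutSecret_surjective hz htN hzn hdiv hV), logb_card_fun,
    card_layoutSecret_index hz htN (hdiv N htN le_rfl), Nat.cast_mul]

theorem layoutScheme_isReliable (hz : z < t) (htN : t ≤ N) (hzn : z ≤ n)
    (hdiv : ∀ e, t ≤ e → e ≤ N → (e - z) ∣ (t - z) * α) (hV : IsStaircaseEncoder V ρ t z) :
    (layoutScheme V ρ t z α).IsReliable (t + 2 * zw) z zw 0 := by
  refine ⟨groupScheme_isPrivate (layoutSecret_surjective hz htN hzn hdiv hV)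
      fun Z hZ => exists_layoutSecret_eq hz htN hdiv hV hZ,
    groupScheme_isResilient fun A hA M h => ?_, fun A hA => ?_⟩
  · exact layoutSecret_eq_zero hz hdiv hV le_rfl htN (E := A) (by omega) M.2
      fun i hi c _ => congrFun (h i hi) c
  · have huniv : (Finset.univ.filter fun c : Fin α => (c : ℕ) < stairWidth t z α t) =
        Finset.univ :=
      Finset.filter_true_of_mem fun c _ => c.2.trans_eq (stairWidth_self hz).symm
    rw [← huniv]
    exact layoutScheme_exists_decoder hz hdiv hV le_rfl htN hA.ge

end StaircaseScheme

section Optimal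

variable {F : Type u} {n k zr zw zro zwo zrw α : ℕ}

theorem exists_isReliable_size_eq_zero (F : Type u) [AddGroup F] [Fintype F] [Nontrivial F]
    (n k zr zw α : ℕ) : ∃ C : Scheme F n α, C.IsReliable k zr zw 0 ∧ C.size = 0 := by
  have hsec : Function.Surjective (0 : PUnit.{1} →+ PUnit.{u + 1}) := fun _ => ⟨0, rfl⟩
  refine ⟨groupScheme (0 : PUnit.{1} →+ PUnit.{u + 1}) 0,
    ⟨groupScheme_isPrivate hsec fun _ _ _ => ⟨0, rfl, fun _ _ => rfl⟩,
      groupScheme_isResilient fun _ _ _ _ => rfl,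
      fun A _ => groupScheme_exists_decoder A _ fun _ _ _ _ _ => rfl⟩, ?_⟩
  rw [groupScheme_size hsec, Fintype.card_punit, Nat.cast_one, Real.logb_one]

theorem exists_isStaircaseEncoder [Field F] [Fintype F] (hq : n ≤ Fintype.card F) {t z : ℕ}
    (hz : z ≤ t) (N : ℕ) :
    ∃ V : Matrix (Fin n) (Fin N) F, IsStaircaseEncoder V (rotateRows N z) t z :=
  have ⟨x⟩ := Function.Embedding.nonempty_of_card_le ((Fintype.card_fin n).trans_le hq)
  ⟨_, isStaircaseEncoder_rotateRows x.injective hz⟩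

theorem omniscientCapacity_mem_achievableSizes [Field F] [Fintype F] (hkn : k ≤ n)
    (hq : n ≤ Fintype.card F) :
    omniscientCapacity k zro zwo zrw α ∈
      achievableSizes F n k (zro + zrw) (zwo + zrw) α := by
  intro ε hε
  by_cases hc : 3 * zrw + 2 * zwo + zro < k
  · obtain ⟨t, rfl⟩ : ∃ t, k = t + 2 * (zwo + zrw) := ⟨k - 2 * (zwo + zrw), by omega⟩
    have hz : zro + zrw < t := by omega
    have hdiv : ∀ e, t ≤ e → e ≤ t → (e - (zro + zrw)) ∣ (t - (zro + zrw)) * α :=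
      fun e hte het => le_antisymm het hte ▸ dvd_mul_right _ _
    obtain ⟨V, hV⟩ := exists_isStaircaseEncoder hq hz.le t
    refine ⟨layoutScheme V (rotateRows t (zro + zrw)) t (zro + zrw) α,
      (layoutScheme_isReliable hz le_rfl (by omega) hdiv hV).mono hε.le, ?_⟩
    rw [layoutScheme_size hz le_rfl (by omega) hdiv hV, omniscientCapacity_eq,
      add_comm (zro + zrw), ← Nat.sub_sub, Nat.add_sub_cancel]
  · obtain ⟨C, hC, hsize⟩ := exists_isReliable_size_eq_zero F n k (zro + zrw) (zwo + zrw) α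
    exact ⟨C, hC.mono hε.le, by rw [hsize, omniscientCapacity, if_neg hc]⟩

theorem optimalCost_eq_mul_stairWidth {d : ℕ} (hc : 3 * zrw + 2 * zwo + zro < k) (hd : k ≤ d)
    (hdiv : (d - (3 * zrw + 2 * zwo + zro)) ∣ (k - (3 * zrw + 2 * zwo + zro)) * α) :
    optimalCost k zro zwo zrw α d =
      d * stairWidth (k - 2 * (zwo + zrw)) (zro + zrw) α (d - 2 * (zwo + zrw)) := by
  have hsub : ∀ m, m - 2 * (zwo + zrw) - (zro + zrw) = m - (3 * zrw + 2 * zwo + zro) := by omega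
  have hne : ((d - (3 * zrw + 2 * zwo + zro) : ℕ) : ℝ) ≠ 0 := by
    exact_mod_cast (by omega : d - (3 * zrw + 2 * zwo + zro) ≠ 0)
  rw [stairWidth, hsub, hsub, Nat.cast_div hdiv hne, Nat.cast_mul, Nat.cast_sub hc.le,
    Nat.cast_sub (hc.le.trans hd), optimalCost, mul_div_assoc]
  congr 2 <;> push_cast <;> ring

/-- A zero-error scheme that attains the claimed capacity, and in which a user contacting any
`d ≥ k` parties decodes from the prefixes of their shares of the length used by Staircase codes, at
the claimed minimum costs. -/
def Scheme.IsOptimal [Fintype F] (C : Scheme F n α) (k zro zwo zrw : ℕ) : Prop :=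
  C.IsReliable k (zro + zrw) (zwo + zrw) 0 ∧
  C.size = omniscientCapacity k zro zwo zrw α ∧
  ∀ D : Finset (Fin n), k ≤ D.card → ∃ dec, ∃ p : Protocol C D,
    p = C.plainDownload D (Finset.univ.filter fun c : Fin α => (c : ℕ) <
      stairWidth (k - 2 * (zwo + zrw)) (zro + zrw) α (D.card - 2 * (zwo + zrw))) dec ∧
    p.ErrorAtMost (zwo + zrw) 0 ∧
    p.commCost = optimalCost k zro zwo zrw α D.card ∧
    p.readCost = optimalCost k zro zwo zrw α D.card

theorem layoutScheme_isOptimal [Ring F] [Nontrivial F] [Fintype F] (hkn : k ≤ n)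
    (hc : 3 * zrw + 2 * zwo + zro < k)
    (hdiv : ∀ d, k ≤ d → d ≤ n →
      (d - (3 * zrw + 2 * zwo + zro)) ∣ (k - (3 * zrw + 2 * zwo + zro)) * α)
    {N : ℕ} (hN : N = n - 2 * (zwo + zrw)) {V : Matrix (Fin n) (Fin N) F} {ρ : Fin N → Fin N}
    (hV : IsStaircaseEncoder V ρ (k - 2 * (zwo + zrw)) (zro + zrw)) :
    (layoutScheme V ρ (k - 2 * (zwo + zrw)) (zro + zrw) α).IsOptimal k zro zwo zrw := by
  have hz : zro + zrw < k - 2 * (zwo + zrw) := by omega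
  have hdivN : ∀ e, k - 2 * (zwo + zrw) ≤ e → e ≤ N →
      (e - (zro + zrw)) ∣ (k - 2 * (zwo + zrw) - (zro + zrw)) * α := fun e hke heN => by
    have hsub : k - 2 * (zwo + zrw) - (zro + zrw) = k - (3 * zrw + 2 * zwo + zro) := by omega
    rw [hsub, (by omega : e - (zro + zrw) =
      e + 2 * (zwo + zrw) - (3 * zrw + 2 * zwo + zro))]
    exact hdiv _ (by omega) (by omega)
  have hreliable := layoutScheme_isReliable (zw := zwo + zrw) hz (by omega) (by omega) hdivN hV
  rw [Nat.sub_add_cancel (by omega)] at hreliable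
  refine ⟨hreliable, ?_, fun D hD => ?_⟩
  · rw [layoutScheme_size hz (by omega) (by omega) hdivN hV, omniscientCapacity_eq, Nat.sub_sub,
      add_comm (2 * (zwo + zrw))]
  have hDn : D.card ≤ n := card_finset_fin_le D
  obtain ⟨dec, hdec⟩ := layoutScheme_exists_decoder (zw := zwo + zrw) (D := D) hz hdivN hV
    (e := D.card - 2 * (zwo + zrw)) (by omega) (by omega) (by omega)
  have hcost := optimalCost_eq_mul_stairWidth hc hD (hdiv _ hD hDn)
  have hinitial := stairWidth_le (α := α) hz (Nat.sub_le_sub_right hD (2 * (zwo + zrw)))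
  refine ⟨dec, _, rfl, hdec, ?_, ?_⟩
  · rw [Scheme.plainDownload_commCost, Fin.card_filter_val_lt, min_eq_right hinitial, hcost]
  · rw [Scheme.plainDownload_readCost, Fin.card_filter_val_lt, min_eq_right hinitial, hcost]

theorem exists_isOptimal [Field F] [Fintype F] (hkn : k ≤ n) (hq : n ≤ Fintype.card F)
    (hc : 3 * zrw + 2 * zwo + zro < k)
    (hdiv : ∀ d, k ≤ d → d ≤ n →
      (d - (3 * zrw + 2 * zwo + zro)) ∣ (k - (3 * zrw + 2 * zwo + zro)) * α) :
    ∃ C : Scheme F n α, C.IsOptimal k zro zwo zrw :=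
  have ⟨_, hV⟩ := exists_isStaircaseEncoder hq (by omega : zro + zrw ≤ k - 2 * (zwo + zrw)) _
  ⟨_, layoutScheme_isOptimal hkn hc hdiv rfl hV⟩

theorem Scheme.IsOptimal.optimalCost_mem [Fintype F] {C : Scheme F n α}
    (hC : C.IsOptimal k zro zwo zrw) {D : Finset (Fin n)} (hD : k ≤ D.card) :
    optimalCost k zro zwo zrw α D.card ∈ commCosts F n k (zro + zrw) (zwo + zrw) α
      (omniscientCapacity k zro zwo zrw α) D ∧
    optimalCost k zro zwo zrw α D.card ∈ readCosts F n k (zro + zrw) (zwo + zrw) α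
      (omniscientCapacity k zro zwo zrw α) D := by
  obtain ⟨hreliable, hsize, hprotocol⟩ := hC
  obtain ⟨-, p, -, hp, hcomm, hread⟩ := hprotocol D hD
  exact ⟨fun ε hε => ⟨C, hreliable.mono hε.le, hsize.ge, p, hp.mono hε.le, hcomm.le⟩,
    fun ε hε => ⟨C, hreliable.mono hε.le, hsize.ge, p, hp.mono hε.le, hread.le⟩⟩

theorem uniformOfFinset_eq_map_val {V : Type*} {s : Finset V} (hs : s.Nonempty) {p : V → Prop}
    [Fintype (Subtype p)] [Nonempty (Subtype p)] (h : ∀ v, v ∈ s ↔ p v) :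
    PMF.uniformOfFinset s hs = (PMF.uniformOfFintype (Subtype p)).map Subtype.val := by
  classical
  ext v
  rw [PMF.uniformOfFinset_apply, PMF.map_apply, ← Fintype.card_of_subtype s h]
  split_ifs with hv
  · rw [tsum_eq_single ⟨v, (h v).1 hv⟩ fun w hw => if_neg fun hvw => hw (Subtype.ext hvw.symm),
      if_pos rfl, PMF.uniformOfFintype_apply]
  · exact (ENNReal.tsum_eq_zero.2 fun w : Subtype p =>
      if_neg fun hvw : v = w => hv ((h v).2 (hvw ▸ w.2))).symm

theorem staircaseCode_eq [Field F] [Fintype F] (x : Fin n → F) (t z N α : ℕ) :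
    staircaseCode x t z N α = layoutScheme (Matrix.rectVandermonde x 1 N) id t z α := by
  classical
  have hshare : ∀ M : Matrix (Fin N) (Fin α) F,
      (fun i c => ∑ r : Fin N, x i ^ (r : ℕ) * M r c) =
        encodedShares (Matrix.rectVandermonde x 1 N) α M := fun M => by
    funext i c
    refine (Finset.sum_congr rfl fun r _ => ?_).trans (Matrix.mul_apply ..).symm
    rw [Matrix.rectVandermonde_apply, Pi.one_apply, one_pow, mul_one]
  have hlaw := uniformOfFinset_eq_map_val (p := (· ∈ layoutSubgroup F id t z α))
    ⟨0, (Finset.mem_filter_univ _).2 (isStaircaseMatrix_iff.2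
      (zero_mem (layoutSubgroup F (id : Fin N → Fin N) t z α)))⟩
    fun M => (Finset.mem_filter_univ M).trans isStaircaseMatrix_iff
  simp only [staircaseCode, hshare, hlaw, PMF.map_comp]
  rfl

theorem staircaseCode_isOptimal [Field F] [Fintype F] (hkn : k ≤ n)
    (hc : 3 * zrw + 2 * zwo + zro < k)
    (hdiv : ∀ d, k ≤ d → d ≤ n →
      (d - (3 * zrw + 2 * zwo + zro)) ∣ (k - (3 * zrw + 2 * zwo + zro)) * α)
    {x : Fin n → F} (hx : Function.Injective x) (hx₀ : ∀ i, x i ≠ 0) :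
    (staircaseCode x (k - 2 * (zwo + zrw)) (zro + zrw) (n - 2 * (zwo + zrw)) α).IsOptimal
      k zro zwo zrw := by
  rw [staircaseCode_eq]
  exact layoutScheme_isOptimal hkn hc hdiv rfl (isStaircaseEncoder_id hx hx₀ (by omega))

end Optimal

end SecretSharing

theorem theorem2 {F : Type u} [Field F] [Fintype F] (n k zro zwo zrw α : ℕ)
    (hkn : k ≤ n) (hzr : zro + zrw < k) (hq : n ≤ Fintype.card F) :
    -- the capacity
    IsGreatest (SecretSharing.achievableSizes F n k (zro + zrw) (zwo + zrw) α)
      (SecretSharing.omniscientCapacity k zro zwo zrw α) ∧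
    (3 * zrw + 2 * zwo + zro < k →
      -- no capacity-achieving schemes have smaller communication or read costs
      (∀ D : Finset (Fin n), k ≤ D.card →
        SecretSharing.optimalCost k zro zwo zrw α D.card ∈
            lowerBounds (SecretSharing.commCosts F n k (zro + zrw) (zwo + zrw) α
              (SecretSharing.omniscientCapacity k zro zwo zrw α) D) ∧
        SecretSharing.optimalCost k zro zwo zrw α D.card ∈
            lowerBounds (SecretSharing.readCosts F n k (zro + zrw) (zwo + zrw) α
              (SecretSharing.omniscientCapacity k zro zwo zrw α) D)) ∧
      -- the case in which the number of symbols per contacted party is an integer for every `d`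
      ((∀ d : ℕ, k ≤ d → d ≤ n →
          (d - (3 * zrw + 2 * zwo + zro)) ∣ (k - (3 * zrw + 2 * zwo + zro)) * α) →
        -- the minimum communication and read costs
        (∀ D : Finset (Fin n), k ≤ D.card →
          IsLeast (SecretSharing.commCosts F n k (zro + zrw) (zwo + zrw) α
              (SecretSharing.omniscientCapacity k zro zwo zrw α) D)
            (SecretSharing.optimalCost k zro zwo zrw α D.card) ∧
          IsLeast (SecretSharing.readCosts F n k (zro + zrw) (zwo + zrw) α
              (SecretSharing.omniscientCapacity k zro zwo zrw α) D)
            (SecretSharing.optimalCost k zro zwo zrw α D.card)) ∧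
        -- a zero-error scheme attains the capacity and all the minimum costs simultaneously
        (∃ C : SecretSharing.Scheme F n α,
          C.IsReliable k (zro + zrw) (zwo + zrw) 0 ∧
          C.size = SecretSharing.omniscientCapacity k zro zwo zrw α ∧
          ∀ D : Finset (Fin n), k ≤ D.card → ∃ p : SecretSharing.Protocol C D,
            p.ErrorAtMost (zwo + zrw) 0 ∧
            p.commCost = SecretSharing.optimalCost k zro zwo zrw α D.card ∧
            p.readCost = SecretSharing.optimalCost k zro zwo zrw α D.card) ∧
        -- Staircase codes are such schemes: the user downloads a prefix of each contacted share
        (∀ x : Fin n → F, Function.Injective x → (∀ i, x i ≠ 0) →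
          ∀ C : SecretSharing.Scheme F n α,
            C = SecretSharing.staircaseCode x (k - 2 * (zwo + zrw)) (zro + zrw)
              (n - 2 * (zwo + zrw)) α →
            C.IsReliable k (zro + zrw) (zwo + zrw) 0 ∧
            C.size = SecretSharing.omniscientCapacity k zro zwo zrw α ∧
            ∀ D : Finset (Fin n), k ≤ D.card →
              ∃ dec, ∃ p : SecretSharing.Protocol C D,
                p = C.plainDownload D
                  (Finset.univ.filter fun c : Fin α => (c : ℕ) <
                    SecretSharing.stairWidth (k - 2 * (zwo + zrw)) (zro + zrw) α
                      (D.card - 2 * (zwo + zrw))) dec ∧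
                p.ErrorAtMost (zwo + zrw) 0 ∧
                p.commCost = SecretSharing.optimalCost k zro zwo zrw α D.card ∧
                p.readCost = SecretSharing.optimalCost k zro zwo zrw α D.card))) := by
  have hcomm := fun (D : Finset (Fin n)) (hD : k ≤ D.card) (hc : 3 * zrw + 2 * zwo + zro < k) =>
    SecretSharing.optimalCost_mem_lowerBounds_commCosts (F := F) (α := α) hkn hc hD
  have hread := fun (D : Finset (Fin n)) hD hc =>
    lowerBounds_mono_set (SecretSharing.readCosts_subset_commCosts _) (hcomm D hD hc)
  refine ⟨⟨SecretSharing.omniscientCapacity_mem_achievableSizes hkn hq,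
    fun H hH => SecretSharing.le_omniscientCapacity hkn hzr hH⟩,
    fun hc => ⟨fun D hD => ⟨hcomm D hD hc, hread D hD hc⟩, fun hdiv => ?_⟩⟩
  obtain ⟨C, hC⟩ := SecretSharing.exists_isOptimal (F := F) hkn hq hc hdiv
  refine ⟨fun D hD => ?_, ⟨C, hC.1, hC.2.1, fun D hD => ?_⟩, ?_⟩
  · obtain ⟨hmem_comm, hmem_read⟩ := hC.optimalCost_mem hD
    exact ⟨⟨hmem_comm, hcomm D hD hc⟩, ⟨hmem_read, hread D hD hc⟩⟩
  · obtain ⟨-, p, -, hp⟩ := hC.2.2 D hD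
    exact ⟨p, hp⟩
  · rintro x hx hx₀ _ rfl
    exact SecretSharing.staircaseCode_isOptimal hkn hc hdiv hx hx₀
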